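/- **Setting.** Let $N\ge 1$ and let $A=[a_{ij}]\in\mathbb R^{N\times N}$ be the symmetric weighted adjacency matrix, with zero diagonal and entries of arbitrary sign, of an undirected signed graph. Let $L$ be its repelling Laplacian, $\ell_{ii}=\sum_k a_{ik}$ and $\ell_{ij}=-a_{ij}$ for $i\ne j$, and let $\lambda_{\min}(L)$ be its smallest eigenvalue. Let $\bar M=\tfrac12N(N-1)$, let $\bar E\in\mathbb R^{N\times\bar M}$ be the incidence matrix of an arbitrary orientation of the complete graph on $N$ nodes, and let $\bar w\in\mathbb R^{\bar M}$ collect the true weights, $\bar w_k=a_{ij}$ for the edge $k=\{i,j\}$ (zero if the edge is absent). Let $f_i:\mathbb R\to\mathbb R$ be smooth. Consider the controlled network $$\dot x_i=f_i(x_i)-\sum_{j}a_{ij}(x_i-x_j)+u_i,\qquad u=-F(x)-c_1(x-\hat x)+\dot{\hat x}+\bar E\,\mathrm{diag}(\hat w)\bar E^\top\hat x,$$ $$\dot{\hat w}=-\mathrm{diag}(\bar E^\top\hat x)\bar E^\top(x-\hat x),\qquad \dot{\hat x}=-\hat x+\phi(t,\xi),$$ where $F(x)=(f_i(x_i))_i$,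 $\xi=(\tilde x,\tilde w)$, $\tilde x=x-\hat x$, $\tilde w=\bar w-\hat w$, and $\phi:\mathbb R_{\ge0}\times\mathbb R^{N+\bar M}\to\mathbb R^N$. With $\hat Z=\mathrm{diag}(\bar E^\top\hat x)$, the closed-loop error system with state $(\xi,\hat x)$ is $$\dot{\tilde x}=-(c_1I+L)\tilde x-\bar E\hat Z\tilde w,\qquad \dot{\tilde w}=\hat Z\bar E^\top\tilde x,\qquad \dot{\hat x}=-\hat x+\phi(t,\xi).\tag{1}$$ **Assumptions.** (a) $\phi$ is locally Lipschitz on $\mathbb R_{\ge0}\times\mathbb R^{N+\bar M}$, and there is a continuous non-decreasing $\rho:\mathbb R_{\ge0}\to\mathbb R_{\ge0}$ such that for all $\xi$ and almost all $t\ge0$ the Euclidean norm of $\phi$ and the norms of those of the derivatives $\partial\phi/\partial t$, $\partial\phi/\partial\xi$ that exist at $(t,\xi)$ are at most $\rho(|\xi|)$. (b) $\phi$ is uniformly $\delta$-persistently exciting with respect to $\xi$ along (1): for all $r,\delta>0$ there are $T,\mu>0$ such that for every $t_0\ge0$ and every solution $(\xi,\hat x)$ of (1) on $[t_0,\infty)$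 with $|(\xi(t_0),\hat x(t_0))|<r$, and every $t\ge t_0$, if $|\xi(s)|\ge\delta$ for all $s\in[t,t+T]$, then $\int_t^{t+T}\phi(\tau,\xi(\tau))\phi(\tau,\xi(\tau))^\top d\tau\ge\mu I$. (c) $c_1>-\lambda_{\min}(L)$. **Conclusion.** 1. The origin $\xi=0$ of the error system (1) is uniformly globally asymptotically stable: for every $t_0\ge 0$ and every initial state, (1) has a solution on $[t_0,\infty)$; there is $\gamma\in\mathcal K_\infty$ with $|\xi(t)|\le\gamma(|\xi(t_0)|)$ along every solution starting at any $t_0\ge0$, as long as it exists; and for all $r,\sigma>0$ there is $T>0$ such that, for every $t_0\ge 0$, every solution on $[t_0,\infty)$ with $|(\xi(t_0),\hat x(t_0))|<r$ satisfies $|\xi(t)|\le\sigma$ for all $t\ge t_0+T$. 2. The controlled network has a trajectory on $[t_0,\infty)$ from every $t_0\ge0$ and every initial condition, and along every such trajectory $\hat w(t)\to\bar w$ and $x(t)-\hat x(t)\to0$ as $t\to\infty$. 3. If moreover $\phi(t,0)=0$ for all $t\ge0$ (so that $(\xi,\hat x)=(0,0)$ is an equilibrium of (1)), then the origin $(\xi,\hat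 x)=(0,0)$ of (1) is uniformly globally asymptotically stable (the property in 1. with $\xi(t)$, $\xi(t_0)$ replaced by $(\xi,\hat x)(t)$, $(\xi,\hat x)(t_0)$ in the estimates), and the network synchronizes: along every trajectory of the controlled network, $x(t)\to0$ and $\hat x(t)\to0$ as $t\to\infty$. -/

import Mathlib

open Set Filter Topology MeasureTheory
open scoped Matrix ContDiff

noncomputable section

namespace SignedNetwork

/-! ## Solutions, class K-infinity, stability, persistency of excitation -/

section General

variable {E F : Type*} [NormedAddCommGroup E] [NormedSpace ℝ E] [NormedAddCommGroup F]

/-- `X` solves `x' = f(t, x)` on the time interval `J` (one-sided derivatives at end points). -/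
def IsSolutionOn (f : ℝ → E → E) (J : Set ℝ) (X : ℝ → E) : Prop :=
  ∀ t ∈ J, HasDerivWithinAt X (f t (X t)) J t

/-- Functions of class `K_∞`, defined on `[0, ∞)`. -/
structure IsKInfty (γ : ℝ → ℝ) : Prop where
  continuousOn : ContinuousOn γ (Ici 0)
  strictMonoOn : StrictMonoOn γ (Ici 0)
  map_zero : γ 0 = 0
  tendsto : Tendsto γ atTop atTop

/-- Uniform global asymptotic stability of `{h = 0}` for `x' = f(t, x)`, `t ≥ 0`, measured through
the output `h(x)`: solutions exist for all later times, uniform global stability holds along every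
solution for as long as it exists, and `h(x(t))` tends to `0` uniformly in the initial time and in
initial states from bounded sets. -/
structure IsUGASWith (h : E → F) (f : ℝ → E → E) : Prop where
  complete : ∀ t₀ : ℝ, 0 ≤ t₀ → ∀ x₀ : E, ∃ X : ℝ → E, X t₀ = x₀ ∧ IsSolutionOn f (Ici t₀) X
  stable : ∃ γ : ℝ → ℝ, IsKInfty γ ∧ ∀ t₀ t₁ : ℝ, 0 ≤ t₀ → ∀ X : ℝ → E,
    IsSolutionOn f (Ico t₀ t₁) X → ∀ t ∈ Ico t₀ t₁, ‖h (X t)‖ ≤ γ ‖h (X t₀)‖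
  attractive : ∀ r σ : ℝ, 0 < r → 0 < σ → ∃ T : ℝ, 0 < T ∧ ∀ t₀ : ℝ, 0 ≤ t₀ → ∀ X : ℝ → E,
    IsSolutionOn f (Ici t₀) X → ‖X t₀‖ < r → ∀ t : ℝ, t₀ + T ≤ t → ‖h (X t)‖ ≤ σ

/-- Uniform global asymptotic stability of the origin of `x' = f(t, x)`. -/
def IsUGAS (f : ℝ → E → E) : Prop := IsUGASWith (id : E → E) f

end General

/-- The matrix `∫_t^{t+T} v(τ) v(τ)ᵀ dτ`. -/
def excitationGram {ι : Type*} (v : ℝ → EuclideanSpace ℝ ι) (t T : ℝ) : Matrix ι ι ℝ :=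
  Matrix.of fun i j => ∫ τ in t..(t + T), v τ i * v τ j

/-- The pair `(φ, f)` is uniformly `δ`-persistently exciting with respect to `x₁`, where
`x = (x₁, x₂)`. The Loewner inequality `Gram ≥ μ I` is positive semidefiniteness of the
difference. -/
def IsUDeltaPE {E₁ E₂ ι : Type*} [NormedAddCommGroup E₁] [InnerProductSpace ℝ E₁]
    [NormedAddCommGroup E₂] [InnerProductSpace ℝ E₂] [Fintype ι] [DecidableEq ι]
    (φ : ℝ → WithLp 2 (E₁ × E₂) → EuclideanSpace ℝ ι)
    (f : ℝ → WithLp 2 (E₁ × E₂) → WithLp 2 (E₁ × E₂)) : Prop :=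
  ∀ r δ : ℝ, 0 < r → 0 < δ → ∃ T μ : ℝ, 0 < T ∧ 0 < μ ∧
    ∀ t₀ : ℝ, 0 ≤ t₀ → ∀ X : ℝ → WithLp 2 (E₁ × E₂),
      ‖X t₀‖ < r → IsSolutionOn f (Ici t₀) X →
      ∀ t : ℝ, t₀ ≤ t → (∀ s ∈ Icc t (t + T), δ ≤ ‖(X s).fst‖) →
        (excitationGram (fun τ => φ τ (X τ)) t T - μ • (1 : Matrix ι ι ℝ)).PosSemidef

/-- The growth bound: `ρ : [0, ∞) → [0, ∞)` is continuous and non-decreasing, and for all `ξ` and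
almost all `t ≥ 0` the norms of `φ`, `∂φ/∂t` and `∂φ/∂ξ` at `(t, ξ)` are at most `ρ(|ξ|)`
(a derivative is bounded where it exists). -/
structure GrowthBound {E F : Type*} [NormedAddCommGroup E] [NormedSpace ℝ E]
    [NormedAddCommGroup F] [NormedSpace ℝ F] (φ : ℝ → E → F) (ρ : ℝ → ℝ) : Prop where
  continuousOn : ContinuousOn ρ (Ici 0)
  monotoneOn : MonotoneOn ρ (Ici 0)
  nonneg : ∀ s : ℝ, 0 ≤ s → 0 ≤ ρ s
  bound : ∀ ξ : E, ∀ᵐ t ∂(volume.restrict (Ici (0 : ℝ))),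
    ‖φ t ξ‖ ≤ ρ ‖ξ‖ ∧
    (∀ v : F, HasDerivAt (fun s => φ s ξ) v t → ‖v‖ ≤ ρ ‖ξ‖) ∧
    (∀ D : E →L[ℝ] F, HasFDerivAt (φ t) D ξ → ‖D‖ ≤ ρ ‖ξ‖)

/-! ## Signed graphs, repelling Laplacian, complete graph -/

/-- An undirected signed graph on `N` nodes without self-loops, given by its weighted adjacency
matrix; `a i j ≠ 0` exactly when `i` and `j` are joined by an edge. -/
structure SignedGraph (N : ℕ) where
  a : Matrix (Fin N) (Fin N) ℝ
  symm : ∀ i j, a i j = a j i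
  loopless : ∀ i, a i i = 0

/-- The repelling signed Laplacian. -/
def SignedGraph.laplacian {N : ℕ} (G : SignedGraph N) : Matrix (Fin N) (Fin N) ℝ :=
  Matrix.of fun i j => if i = j then ∑ k, G.a i k else -G.a i j

/-- The edges of the complete graph on `N` nodes. -/
abbrev Edge (N : ℕ) : Type := {e : Sym2 (Fin N) // ¬ e.IsDiag}

/-- An orientation of the complete graph: an initial and a terminal node for each edge. -/
structure EdgeOrientation (N : ℕ) where
  src : Edge N → Fin N
  tgt : Edge N → Fin N
  spec : ∀ e : Edge N, s(src e, tgt e) = e.1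

/-- The incidence matrix of the oriented complete graph. -/
def EdgeOrientation.incidence {N : ℕ} (o : EdgeOrientation N) : Matrix (Fin N) (Edge N) ℝ :=
  Matrix.of fun i e => if i = o.src e then 1 else if i = o.tgt e then -1 else 0

/-- Vectors indexed by the nodes. -/
abbrev NodeVec (N : ℕ) : Type := EuclideanSpace ℝ (Fin N)

/-- Vectors indexed by the edges of the complete graph. -/
abbrev EdgeVec (N : ℕ) : Type := EuclideanSpace ℝ (Edge N)

/-- The errors `ξ = (x̃, w̃)`, with the Euclidean norm. -/
abbrev ErrVec (N : ℕ) : Type := WithLp 2 (NodeVec N × EdgeVec N)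

/-- The states `(ξ, x̂)`, with the Euclidean norm. -/
abbrev LoopVec (N : ℕ) : Type := WithLp 2 (ErrVec N × NodeVec N)

/-- The true weights, one for each edge of the complete graph (zero for an absent edge). -/
def SignedGraph.weights {N : ℕ} (G : SignedGraph N) (o : EdgeOrientation N) : EdgeVec N :=
  WithLp.toLp 2 fun e => G.a (o.src e) (o.tgt e)

/-- Matrix times vector. -/
def act {m n : Type*} [Fintype n] (A : Matrix m n ℝ) (x : EuclideanSpace ℝ n) :
    EuclideanSpace ℝ m :=
  WithLp.toLp 2 (A *ᵥ x.ofLp)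

/-- The matrix `Ẑ = diag(Ēᵀ x̂)`. -/
def EdgeOrientation.zDiag {N : ℕ} (o : EdgeOrientation N) (xh : NodeVec N) :
    Matrix (Edge N) (Edge N) ℝ :=
  Matrix.diagonal (act o.incidenceᵀ xh).ofLp

/-- The estimated Laplacian `L̂ = Ē diag(ŵ) Ēᵀ`. -/
def EdgeOrientation.estLaplacian {N : ℕ} (o : EdgeOrientation N) (wh : EdgeVec N) :
    Matrix (Fin N) (Fin N) ℝ :=
  o.incidence * Matrix.diagonal wh.ofLp * o.incidenceᵀ

/-! ## The closed loop -/

/-- The closed-loop error dynamics together with the auxiliary system: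
`x̃' = -(c₁ I + L) x̃ - Ē Ẑ w̃`, `w̃' = Ẑ Ēᵀ x̃`, `x̂' = -x̂ + φ(t, ξ)`, with `ξ = (x̃, w̃)`. -/
def errorField {N : ℕ} (G : SignedGraph N) (o : EdgeOrientation N) (c₁ : ℝ)
    (φ : ℝ → ErrVec N → NodeVec N) (t : ℝ) (X : LoopVec N) : LoopVec N :=
  WithLp.toLp 2
    (WithLp.toLp 2
      (-act (c₁ • (1 : Matrix (Fin N) (Fin N) ℝ) + G.laplacian) X.fst.fst
          - act (o.incidence * o.zDiag X.snd) X.fst.snd,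
        act (o.zDiag X.snd * o.incidenceᵀ) X.fst.fst),
      -X.snd + φ t X.fst)

/-- The errors `ξ = (x - x̂, w̄ - ŵ)`. -/
def errorOf {N : ℕ} (G : SignedGraph N) (o : EdgeOrientation N) (x xh : NodeVec N)
    (wh : EdgeVec N) : ErrVec N :=
  WithLp.toLp 2 (x - xh, G.weights o - wh)

/-- The control input `u = -F(x) - c₁ (x - x̂) + x̂' + L̂ x̂`, with `x̂' = -x̂ + φ(t, ξ)`. -/
def controlInput {N : ℕ} (G : SignedGraph N) (o : EdgeOrientation N) (f : Fin N → ℝ → ℝ) (c₁ : ℝ)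
    (φ : ℝ → ErrVec N → NodeVec N) (t : ℝ) (x xh : NodeVec N) (wh : EdgeVec N) : NodeVec N :=
  -WithLp.toLp 2 (fun i => f i (x i)) - c₁ • (x - xh)
    + (-xh + φ t (errorOf G o x xh wh)) + act (o.estLaplacian wh) xh

/-- `(x, x̂, ŵ)` is a trajectory on `[t₀, ∞)` of the controlled network
`xᵢ' = fᵢ(xᵢ) - ∑ⱼ aᵢⱼ (xᵢ - xⱼ) + uᵢ`, with the auxiliary system and the update law
`ŵ' = -diag(Ēᵀ x̂) Ēᵀ (x - x̂)`. -/
structure IsNetworkTrajectory {N : ℕ} (G : SignedGraph N) (o : EdgeOrientation N)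
    (f : Fin N → ℝ → ℝ) (c₁ : ℝ) (φ : ℝ → ErrVec N → NodeVec N) (t₀ : ℝ)
    (x xh : ℝ → NodeVec N) (wh : ℝ → EdgeVec N) : Prop where
  agents : ∀ t ∈ Ici t₀, ∀ i : Fin N,
    HasDerivWithinAt (fun s => x s i)
      (f i (x t i) - ∑ j, G.a i j * (x t i - x t j)
        + controlInput G o f c₁ φ t (x t) (xh t) (wh t) i) (Ici t₀) t
  auxiliary : ∀ t ∈ Ici t₀,
    HasDerivWithinAt xh (-xh t + φ t (errorOf G o (x t) (xh t) (wh t))) (Ici t₀) t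
  update : ∀ t ∈ Ici t₀,
    HasDerivWithinAt wh (-act (o.zDiag (xh t) * o.incidenceᵀ) (x t - xh t)) (Ici t₀) t

end SignedNetwork

end

open SignedNetwork

noncomputable section

namespace SignedNetwork

/-! ## Lipschitz bounds from almost everywhere bounds on derivatives -/

section LipschitzBounds

open Metric

/-! The error system is an instance of an abstract adaptive loop x' = -Ax - B(w)z, w' = C(z)x, z' =
-z + φ(t, ξ) with ξ = (x, w), where A = c₁I + L is coercive, B(w)z = Ē diag(w) Ēᵀz, and B, C are
adjoint in the sense ⟨x, B(w)z⟩ = ⟨w, C(z)x⟩. Adjointness cancels the cross terms, so (|ξ|²)' =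
-2⟨x, Ax⟩ ≤ 0. Hence |ξ| never increases, z is bounded because φ is bounded along ξ, and solutions
are global; this is uniform stability with γ = id.

Attractivity is argued by contradiction (`IsAdaptiveLoop.attractive`). If |ξ| stays above σ for ever
longer times, cut those times into windows of the excitation length T. The total decrease of |ξ|² is
at most r², so some window carries an arbitrarily small decrease. On such windows a quantitative
Barbalat argument (`UnifSmall.deriv`: small oscillation and Lipschitz derivative force a small
derivative) is iterated in `IsAdaptiveLoop.unifSmall_windows`: x is small, then x' and hence B(w)z,
then (B(w)z)' and hence B(w)φ; as w is nearly constant, B(w(a))φ is small for the value w(a) at the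
left end of the window. Excitation makes w(a) small, so |ξ(a)| < σ, a contradiction.

Two inputs feed this scheme. The derivative bounds on φ hold only almost everywhere, and Fubini
arguments convert them into Lipschitz bounds uniform in time (`GrowthBound.norm_sub_time_le`,
`GrowthBound.norm_sub_le`). Excitation of φ is transferred to B(w)φ because every weight occurs as
an off-diagonal entry of Ē diag(w) Ēᵀ (`isExcitedAlong`). If φ(t, 0) = 0, the filter z inherits the
decay of ξ, which gives stability of the full state. -/

theorem continuous_clamped {E F : Type*} [NormedAddCommGroup E] [NormedAddCommGroup F]
    {φ : ℝ → E → F}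
    (hφ : LocallyLipschitzOn (Ici (0 : ℝ) ×ˢ (univ : Set E)) fun p : ℝ × E => φ p.1 p.2) :
    Continuous (Function.uncurry fun t x => φ (max t 0) x) :=
  hφ.continuousOn.comp_continuous (f := fun p : ℝ × E => (max p.1 0, p.2)) (by fun_prop)
    fun p => mem_prod.2 ⟨mem_Ici.2 (le_max_right _ _), mem_univ _⟩

theorem continuousOn_time {E F : Type*} [NormedAddCommGroup E] [NormedAddCommGroup F]
    {φ : ℝ → E → F}
    (hφ : LocallyLipschitzOn (Ici (0 : ℝ) ×ˢ (univ : Set E)) fun p : ℝ × E => φ p.1 p.2) (ξ : E) :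
    ContinuousOn (fun t => φ t ξ) (Ici 0) :=
  hφ.continuousOn.comp (f := fun t : ℝ => (t, ξ)) (by fun_prop) fun _ ht => ⟨ht, mem_univ _⟩

theorem exists_lipschitzOnWith_slab {E F : Type*} [NormedAddCommGroup E] [NormedSpace ℝ E]
    [FiniteDimensional ℝ E] [NormedAddCommGroup F] {φ : ℝ → E → F}
    (hφ : LocallyLipschitzOn (Ici (0 : ℝ) ×ˢ (univ : Set E)) fun p : ℝ × E => φ p.1 p.2)
    (τ R : ℝ) : ∃ K, LipschitzOnWith K (fun p : ℝ × E => φ p.1 p.2)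
      (Icc 0 τ ×ˢ closedBall (0 : E) R) :=
  have : ProperSpace E := FiniteDimensional.proper ℝ E
  LocallyLipschitzOn.exists_lipschitzOnWith_of_compact
    (isCompact_Icc.prod (isCompact_closedBall _ _))
    (hφ.mono (prod_mono (fun _ h => h.1) (subset_univ _)))

/-- Continuous functions that agree almost everywhere agree everywhere on such a set; this is
applied to max(h, C) and C. It removes all exceptional null sets below. -/
theorem le_of_ae_restrict_le {X : Type*} [TopologicalSpace X] [MeasurableSpace X]
    {μ : Measure X} [μ.IsOpenPosMeasure] {s : Set X} {h : X → ℝ} {C : ℝ}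
    (hs : s ⊆ closure (interior s)) (hc : ContinuousOn h s)
    (hae : ∀ᵐ x ∂(μ.restrict s), h x ≤ C) : ∀ x ∈ s, h x ≤ C := by
  have key : EqOn (fun x => max (h x) C) (fun _ => C) s := by
    refine Measure.eqOn_of_ae_eq (μ := μ) ?_ (hc.sup continuousOn_const) continuousOn_const hs
    filter_upwards [hae] with x hx
    exact max_eq_right hx
  intro x hx
  exact (le_max_left _ _).trans_eq (key hx)

theorem GrowthBound.norm_le {E F : Type*} [NormedAddCommGroup E] [NormedSpace ℝ E]
    [NormedAddCommGroup F] [NormedSpace ℝ F] {φ : ℝ → E → F} {ρ : ℝ → ℝ}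
    (hρ : GrowthBound φ ρ)
    (hφ : LocallyLipschitzOn (Ici (0 : ℝ) ×ˢ (univ : Set E)) fun p : ℝ × E => φ p.1 p.2)
    {t : ℝ} (ht : 0 ≤ t) (ξ : E) : ‖φ t ξ‖ ≤ ρ ‖ξ‖ :=
  le_of_ae_restrict_le (by simp) (continuousOn_time hφ ξ).norm
    ((hρ.bound ξ).mono fun _ h => h.1) t ht

variable {E F : Type*} [NormedAddCommGroup E] [NormedSpace ℝ E] [FiniteDimensional ℝ E]
  [NormedAddCommGroup F] [InnerProductSpace ℝ F] [FiniteDimensional ℝ F]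

/-- Pairing g with its own increment u gives a scalar Lipschitz, hence absolutely continuous,
function, so the fundamental theorem of calculus yields |u|² ≤ |u| C |b - a|. -/
theorem norm_sub_le_of_ae_norm_deriv_le {g : ℝ → F} {a b C : ℝ} {K : NNReal}
    (hg : LipschitzOnWith K g (uIcc a b))
    (hd : ∀ᵐ x, x ∈ uIcc a b → ∀ v, HasDerivAt g v x → ‖v‖ ≤ C) :
    ‖g b - g a‖ ≤ C * |b - a| := by
  set u := g b - g a with hu
  have hlip : LipschitzOnWith (‖u‖₊ * K) (fun x => inner ℝ u (g x)) (uIcc a b) := by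
    refine LipschitzWith.comp_lipschitzOnWith (f := fun y => inner ℝ u y) ?_ hg
    refine LipschitzWith.of_dist_le_mul fun y z => ?_
    rw [Real.dist_eq, ← inner_sub_right, dist_eq_norm]
    exact abs_real_inner_le_norm _ _
  have hint := hlip.absolutelyContinuousOnInterval.integral_deriv_eq_sub
  have hbound : ‖∫ x in a..b, deriv (fun x => inner ℝ u (g x)) x‖ ≤ (‖u‖ * C) * |b - a| := by
    refine intervalIntegral.norm_integral_le_of_norm_le_const_ae ?_
    have hab : ∀ᵐ x : ℝ, x ≠ max a b := by
      simp [ae_iff]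
    filter_upwards [hd, hg.ae_differentiableWithinAt_of_mem_real, hab] with x hx hdx hxb hxab
    have hxI : x ∈ uIcc a b := uIoc_subset_uIcc hxab
    have hnhds : uIcc a b ∈ 𝓝 x := Icc_mem_nhds hxab.1 (lt_of_le_of_ne hxab.2 hxb)
    have hda := ((hdx hxI).differentiableAt hnhds).hasDerivAt
    have h1 : HasDerivAt (fun x => inner ℝ u (g x)) (inner ℝ u (deriv g x)) x := by
      simpa using (hasDerivAt_const x u).inner ℝ hda
    rw [h1.deriv]
    calc ‖inner ℝ u (deriv g x)‖ ≤ ‖u‖ * ‖deriv g x‖ := norm_inner_le_norm _ _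
      _ ≤ ‖u‖ * C := by gcongr; exact hx hxI _ hda
  rw [hint, ← inner_sub_right, ← hu, real_inner_self_eq_norm_sq, Real.norm_of_nonneg (by positivity)]
    at hbound
  -- For u = 0 the claim still needs C ≥ 0 when a ≠ b. This comes from one point of
  -- differentiability, which exists because the interval has positive measure.
  rcases (norm_nonneg u).eq_or_lt with h0 | h0
  · rw [← h0]
    rcases eq_or_ne a b with rfl | hne
    · simp
    · have : (volume (uIcc a b)) ≠ 0 := by
        rw [Real.volume_interval]
        simpa [sub_eq_zero] using hne.symm
      have hex : ∃ x ∈ uIcc a b, ∃ v, ‖v‖ ≤ C ∧ HasDerivAt g v x := by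
        by_contra hcon
        push Not at hcon
        apply this
        have hab : ∀ᵐ x : ℝ, x ≠ max a b := by simp [ae_iff]
        have hab' : ∀ᵐ x : ℝ, x ≠ min a b := by simp [ae_iff]
        have : ∀ᵐ x : ℝ, x ∉ uIcc a b := by
          filter_upwards [hd, hg.ae_differentiableWithinAt_of_mem_real, hab, hab']
            with x hx hdx h1 h2 hmem
          have hnhds : uIcc a b ∈ 𝓝 x :=
            Icc_mem_nhds (lt_of_le_of_ne hmem.1 h2.symm) (lt_of_le_of_ne hmem.2 h1)
          have hda := ((hdx hmem).differentiableAt hnhds).hasDerivAt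
          exact hcon x hmem _ (hx hmem _ hda) hda
        simpa [ae_iff] using this
      obtain ⟨_, _, v, hv, _⟩ := hex
      have := (norm_nonneg v).trans hv
      positivity
  · have : ‖u‖ * ‖u‖ ≤ ‖u‖ * (C * |b - a|) := by nlinarith
    exact le_of_mul_le_mul_left this h0

/-- The segment from x to y may lie inside the bad null set. By Fubini, almost every parallel
translate of it meets that set in a null set of parameters, so the one-dimensional bound applies
there; continuity then returns to the original segment. -/
theorem norm_sub_le_of_ae_norm_fderiv_le [MeasurableSpace E] [BorelSpace E] {μ : Measure E}
    [μ.IsAddHaarMeasure] {ψ : E → F} {U : Set E} {C : ℝ} {K : NNReal} (hU : IsOpen U)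
    (hconv : Convex ℝ U) (hψ : LipschitzOnWith K ψ U)
    (hd : ∀ᵐ x ∂μ, x ∈ U → ∀ D : E →L[ℝ] F, HasFDerivAt ψ D x → ‖D‖ ≤ C)
    {x y : E} (hx : x ∈ U) (hy : y ∈ U) : ‖ψ y - ψ x‖ ≤ C * ‖y - x‖ := by
  set v := y - x with hv
  have hgood : ∀ᵐ z ∂μ, z ∈ U → DifferentiableAt ℝ ψ z ∧ ‖fderiv ℝ ψ z‖ ≤ C := by
    filter_upwards [hd, hψ.ae_differentiableWithinAt_of_mem (μ := μ)] with z hz hdz hzU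
    have := (hdz hzU).differentiableAt (hU.mem_nhds hzU)
    exact ⟨this, hz hzU _ this.hasFDerivAt⟩
  obtain ⟨N, hN, hNm, hN0⟩ := exists_measurable_superset_of_null (ae_iff.mp hgood)
  have hline : ∀ᵐ z ∂μ, ∀ᵐ s : ℝ, z + s • v ∉ N := by
    rw [Measure.ae_ae_comm]
    · refine Eventually.of_forall fun s => ?_
      have : ∀ᵐ z ∂μ, z ∉ N := by simpa [ae_iff] using hN0
      exact (measurePreserving_add_right μ (s • v)).quasiMeasurePreserving.ae this
    · have hm : Measurable (fun p : E × ℝ => p.1 + p.2 • v) := by fun_prop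
      exact (hm hNm).compl
  set W := U ∩ (fun z => z + v) ⁻¹' U with hW
  have hWo : IsOpen W := hU.inter (hU.preimage (by fun_prop))
  have hae : ∀ᵐ z ∂(μ.restrict W), ‖ψ (z + v) - ψ z‖ ≤ C * ‖v‖ := by
    rw [ae_restrict_iff' hWo.measurableSet]
    filter_upwards [hline] with z hz hzW
    have hseg : ∀ s ∈ Icc (0 : ℝ) 1, z + s • v ∈ U := fun s hs =>
      hconv.add_smul_mem hzW.1 hzW.2 hs
    have hl : LipschitzOnWith (K * ‖v‖₊) (fun s : ℝ => ψ (z + s • v)) (uIcc 0 1) := by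
      rw [uIcc_of_le zero_le_one]
      refine hψ.comp (g := ψ) (f := fun s : ℝ => z + s • v) ?_ hseg
      refine LipschitzWith.lipschitzOnWith (LipschitzWith.of_dist_le_mul fun s t => ?_)
      rw [dist_add_left, dist_eq_norm, ← sub_smul, norm_smul, mul_comm]
      rfl
    have := norm_sub_le_of_ae_norm_deriv_le (C := C * ‖v‖) hl ?_
    · simpa using this
    · filter_upwards [hz] with s hs hmem w hw
      rw [uIcc_of_le zero_le_one] at hmem
      have h1 : z + s • v ∈ U → DifferentiableAt ℝ ψ (z + s • v) ∧ ‖fderiv ℝ ψ (z + s • v)‖ ≤ C := by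
        by_contra hcon
        exact hs (hN hcon)
      obtain ⟨h2, h3⟩ := h1 (hseg s hmem)
      have hlin : HasDerivAt (fun s : ℝ => z + s • v) v s := by
        simpa using ((hasDerivAt_id s).smul_const v).const_add z
      have h4 := h2.hasFDerivAt.comp_hasDerivAt s hlin
      rw [hw.unique h4]
      exact (ContinuousLinearMap.le_opNorm _ _).trans (by gcongr)
  have hcont : ContinuousOn (fun z => ‖ψ (z + v) - ψ z‖) W :=
    ((hψ.continuousOn.comp (by fun_prop) fun z hz => hz.2).sub
      (hψ.continuousOn.mono inter_subset_left)).norm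
  have hxW : x ∈ W := ⟨hx, by simpa [hv] using hy⟩
  have := le_of_ae_restrict_le (by rw [hWo.interior_eq]; exact subset_closure) hcont hae x hxW
  simpa [hv] using this

variable {φ : ℝ → E → F} {ρ : ℝ → ℝ}

theorem GrowthBound.norm_sub_time_le (hρ : GrowthBound φ ρ)
    (hφ : LocallyLipschitzOn (Ici (0 : ℝ) ×ˢ (univ : Set E)) fun p : ℝ × E => φ p.1 p.2)
    {s t : ℝ} (hs : 0 ≤ s) (ht : 0 ≤ t) (ξ : E) : ‖φ t ξ - φ s ξ‖ ≤ ρ ‖ξ‖ * |t - s| := by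
  obtain ⟨K, hK⟩ := exists_lipschitzOnWith_slab hφ (max s t) ‖ξ‖
  have hsub : uIcc s t ⊆ Ici 0 := fun u hu => (le_min hs ht).trans hu.1
  have hl : LipschitzOnWith K (fun u => φ u ξ) (uIcc s t) := by
    rw [← mul_one K]
    refine hK.comp (f := fun u : ℝ => (u, ξ)) (LipschitzWith.prodMk_right ξ).lipschitzOnWith ?_
    exact fun u hu => ⟨⟨hsub hu, hu.2⟩, by simp⟩
  refine norm_sub_le_of_ae_norm_deriv_le hl ?_
  filter_upwards [(ae_restrict_iff' measurableSet_Ici).mp (hρ.bound ξ)] with u hu hmem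
  exact (hu (hsub hmem)).2.1

/-- The exceptional times depend on ξ. Fubini exchanges the quantifiers: for almost every t the
derivative bound holds for almost every ξ, so the Lipschitz estimate holds at those t, and
continuity in t gives the others. -/
theorem GrowthBound.norm_sub_le (hρ : GrowthBound φ ρ)
    (hφ : LocallyLipschitzOn (Ici (0 : ℝ) ×ˢ (univ : Set E)) fun p : ℝ × E => φ p.1 p.2)
    {t : ℝ} (ht : 0 ≤ t) {R : ℝ} {x y : E} (hx : ‖x‖ < R) (hy : ‖y‖ < R) :
    ‖φ t y - φ t x‖ ≤ ρ R * ‖y - x‖ := by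
  let : MeasurableSpace E := borel E
  have : BorelSpace E := ⟨rfl⟩
  have : ProperSpace E := FiniteDimensional.proper ℝ E
  set μ : Measure E := Measure.addHaar
  -- Freezing φ for negative times makes it continuous on the whole space, as needed for
  -- measurability of the set where it is differentiable.
  have hc := continuous_clamped hφ
  set P : ℝ → E → Prop := fun t ξ => ξ ∈ ball (0 : E) R →
    DifferentiableAt ℝ (fun x => φ (max t 0) x) ξ →
      DifferentiableAt ℝ (fun x => φ (max t 0) x) ξ ∧
        fderiv ℝ (fun x => φ (max t 0) x) ξ ∈ closedBall (0 : E →L[ℝ] F) (ρ R) with hP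
  have hPm : MeasurableSet {p : ℝ × E | P p.1 p.2} := by
    have h1 := measurableSet_of_differentiableAt_of_isComplete_with_param (𝕜 := ℝ) hc
      (isClosed_closedBall (x := (0 : E →L[ℝ] F)) (ε := ρ R)).isComplete
    have h2 := measurableSet_of_differentiableAt_with_param ℝ hc
    have h3 : MeasurableSet {p : ℝ × E | p.2 ∈ ball (0 : E) R} :=
      measurable_snd measurableSet_ball
    have : {p : ℝ × E | P p.1 p.2} = {p : ℝ × E | p.2 ∈ ball (0 : E) R}ᶜ ∪
        ({p : ℝ × E | DifferentiableAt ℝ (fun x => φ (max p.1 0) x) p.2}ᶜ ∪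
        {p : ℝ × E | DifferentiableAt ℝ (fun x => φ (max p.1 0) x) p.2 ∧
          fderiv ℝ (fun x => φ (max p.1 0) x) p.2 ∈ closedBall (0 : E →L[ℝ] F) (ρ R)}) := by
      ext p
      simp only [hP, mem_ofPred_eq, mem_union, mem_compl_iff]
      tauto
    rw [this]
    exact h3.compl.union (h2.compl.union h1)
  have hae : ∀ᵐ t : ℝ ∂(volume.restrict (Ici 0)), ∀ᵐ ξ ∂μ, P t ξ := by
    rw [Measure.ae_ae_comm hPm]
    refine Eventually.of_forall fun ξ => ?_
    filter_upwards [hρ.bound ξ, ae_restrict_mem measurableSet_Ici] with s hs hs0 hξ hdiff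
    rw [mem_ball_zero_iff] at hξ
    refine ⟨hdiff, ?_⟩
    rw [mem_closedBall_zero_iff]
    have hR : ρ ‖ξ‖ ≤ ρ R := hρ.monotoneOn (norm_nonneg ξ) ((norm_nonneg ξ).trans hξ.le) hξ.le
    refine (hs.2.2 _ ?_).trans hR
    have := hdiff.hasFDerivAt
    rwa [show max s 0 = s from max_eq_left hs0] at this ⊢
  have hxy : ContinuousOn (fun s => ‖φ s y - φ s x‖) (Ici 0) :=
    ((continuousOn_time hφ y).sub (continuousOn_time hφ x)).norm
  refine le_of_ae_restrict_le (μ := volume) (by simp) hxy ?_ t ht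
  filter_upwards [hae, ae_restrict_mem measurableSet_Ici] with s hs hs0
  obtain ⟨K, hK⟩ := exists_lipschitzOnWith_slab hφ s R
  have hl : LipschitzOnWith K (fun z => φ s z) (ball 0 R) := by
    rw [← mul_one K]
    refine hK.comp (f := fun z : E => (s, z)) (LipschitzWith.prodMk_left s).lipschitzOnWith ?_
    exact fun z hz => ⟨⟨hs0, le_rfl⟩, ball_subset_closedBall hz⟩
  refine norm_sub_le_of_ae_norm_fderiv_le (μ := μ) isOpen_ball (convex_ball _ _) hl ?_
    (by simpa using hx) (by simpa using hy)
  filter_upwards [hs] with z hz hzR D hD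
  have hs' : max s 0 = s := max_eq_left hs0
  simp only [hP, hs'] at hz
  have := (hz hzR hD.differentiableAt).2
  rwa [hD.fderiv, mem_closedBall_zero_iff] at this

end LipschitzBounds

/-! ## Global existence from an a priori bound -/

section GlobalExistence

open Metric

theorem IsSolutionOn.mono {E : Type*} [NormedAddCommGroup E] [NormedSpace ℝ E] {f : ℝ → E → E}
    {J J' : Set ℝ} {X : ℝ → E} (hX : IsSolutionOn f J X) (h : J' ⊆ J) : IsSolutionOn f J' X :=
  fun t ht => (hX t (h ht)).mono h

theorem IsSolutionOn.continuousOn {E : Type*} [NormedAddCommGroup E] [NormedSpace ℝ E]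
    {f : ℝ → E → E} {J : Set ℝ} {X : ℝ → E} (hX : IsSolutionOn f J X) : ContinuousOn X J :=
  fun t ht => (hX t ht).continuousWithinAt

variable {E : Type*} [NormedAddCommGroup E] [InnerProductSpace ℝ E] [FiniteDimensional ℝ E]
  {f : ℝ → E → E}

/-- Precomposing with a smooth cutoff makes the field bounded and Lipschitz, so it has a solution on
the whole interval. Up to the first time its norm reaches R + 1 this solves the original equation,
so the a priori bound R excludes such a time. -/
theorem exists_solution_Icc
    (hf : LocallyLipschitzOn (Ici (0 : ℝ) ×ˢ (univ : Set E)) fun p : ℝ × E => f p.1 p.2)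
    {t₀ τ R : ℝ} (ht₀ : 0 ≤ t₀) (hτ : t₀ ≤ τ) {x₀ : E} (hx₀ : ‖x₀‖ ≤ R)
    (hR : ∀ (t₁ : ℝ) (X : ℝ → E), X t₀ = x₀ → IsSolutionOn f (Ico t₀ t₁) X →
      ∀ t ∈ Ico t₀ t₁, ‖X t‖ ≤ R) :
    ∃ X : ℝ → E, X t₀ = x₀ ∧ IsSolutionOn f (Icc t₀ τ) X := by
  have hR0 : 0 ≤ R := (norm_nonneg _).trans hx₀
  let χ : ContDiffBump (0 : E) := ⟨R + 1, R + 2, by linarith, by linarith⟩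
  set P : E → E := fun x => χ x • x with hP
  have hPball : ∀ x, P x ∈ closedBall (0 : E) (R + 2) := by
    intro x
    rw [mem_closedBall_zero_iff, hP, norm_smul, Real.norm_of_nonneg χ.nonneg]
    by_cases hx : ‖x‖ < R + 2
    · exact (mul_le_of_le_one_left (norm_nonneg _) χ.le_one).trans hx.le
    · have : χ x = 0 := χ.zero_of_le_dist (by simpa [dist_zero_right] using hx)
      rw [this, zero_mul]
      linarith
  have hPid : ∀ x, ‖x‖ < R + 1 → P x = x := by
    intro x hx
    have : χ x = 1 := χ.one_of_mem_closedBall (by simpa using hx.le)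
    simp [hP, this]
  have hPc : ContDiff ℝ 1 P := χ.contDiff.smul contDiff_id
  obtain ⟨KP, hKP⟩ := hPc.lipschitzWith_of_hasCompactSupport
    (χ.hasCompactSupport.smul_right (f' := fun x : E => x)) one_ne_zero
  obtain ⟨K, hK⟩ := exists_lipschitzOnWith_slab hf τ (R + 2)
  have hfc : ContinuousOn (fun p : ℝ × E => f p.1 p.2) (Icc t₀ τ ×ˢ closedBall (0 : E) (R + 2)) :=
    hf.continuousOn.mono (prod_mono (fun t ht => ht₀.trans ht.1) (subset_univ _))
  obtain ⟨M, hM⟩ := (isCompact_Icc.prod (isCompact_closedBall (0 : E) (R + 2))).exists_bound_of_continuousOn hfc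
  -- The cut-off field is bounded by M, so a ball of radius M(τ - t₀) cannot be left before time τ.
  have hPL : IsPicardLindelof (fun t x => f t (P x)) (⟨t₀, left_mem_Icc.2 hτ⟩ : Icc t₀ τ) x₀
      (M.toNNReal * (τ - t₀).toNNReal) 0 M.toNNReal (K * (1 * KP)) := by
    refine ⟨fun t ht => ?_, fun x _ => ?_, fun t ht x _ => ?_, ?_⟩
    · refine hK.comp (f := fun z : E => (t, P z)) ?_ ?_
      · exact ((LipschitzWith.prodMk_left t).comp hKP).lipschitzOnWith
      · exact fun z _ => ⟨⟨ht₀.trans ht.1, ht.2⟩, hPball z⟩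
    · exact hfc.comp (f := fun t : ℝ => (t, P x)) (by fun_prop) fun t ht => ⟨ht, hPball x⟩
    · exact (hM (t, P x) ⟨ht, hPball x⟩).trans (Real.le_coe_toNNReal M)
    · simp [hτ]
  obtain ⟨X, hX0, hX⟩ := hPL.exists_eq_forall_mem_Icc_hasDerivWithinAt₀
  have hXc : ContinuousOn X (Icc t₀ τ) := fun t ht => (hX t ht).continuousWithinAt
  have hlt : ∀ t ∈ Icc t₀ τ, ‖X t‖ < R + 1 := by
    by_contra hcon
    push Not at hcon
    set S := {t ∈ Icc t₀ τ | R + 1 ≤ ‖X t‖} with hS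
    have hSc : IsCompact S := by
      refine isCompact_Icc.of_isClosed_subset ?_ (sep_subset _ _)
      exact isClosed_Icc.isClosed_le continuousOn_const hXc.norm
    obtain ⟨s, hs⟩ := hSc.exists_isLeast hcon
    have hsI : s ∈ Icc t₀ τ := hs.1.1
    have hne : t₀ < s := by
      refine lt_of_le_of_ne hsI.1 fun h => ?_
      have h1 := hs.1.2
      rw [← h, show X t₀ = x₀ from hX0] at h1
      linarith
    have hsub : Ico t₀ s ⊆ Icc t₀ τ := fun u hu => ⟨hu.1, hu.2.le.trans hsI.2⟩
    have hsol : IsSolutionOn f (Ico t₀ s) X := by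
      intro u hu
      have hu1 : ‖X u‖ < R + 1 := by
        by_contra h
        exact absurd (hs.2 ⟨hsub hu, not_lt.1 h⟩) (not_le.2 hu.2)
      have := (hX u (hsub hu)).mono hsub
      rwa [hPid _ hu1] at this
    have hbd := hR s X hX0 hsol
    have hcw : ContinuousWithinAt (fun u => ‖X u‖) (Ico t₀ s) s :=
      ((hXc s hsI).mono hsub).norm
    have hmem : s ∈ closure (Ico t₀ s) := by
      rw [closure_Ico hne.ne]
      exact right_mem_Icc.2 hne.le
    have := hcw.closure_le hmem continuousWithinAt_const hbd
    linarith [hs.1.2]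
  refine ⟨X, hX0, fun t ht => ?_⟩
  have := hX t ht
  rwa [hPid _ (hlt t ht)] at this

theorem eqOn_of_solutions
    (hf : LocallyLipschitzOn (Ici (0 : ℝ) ×ˢ (univ : Set E)) fun p : ℝ × E => f p.1 p.2)
    {t₀ τ : ℝ} (ht₀ : 0 ≤ t₀) {X Y : ℝ → E} (hX : IsSolutionOn f (Icc t₀ τ) X)
    (hY : IsSolutionOn f (Icc t₀ τ) Y) (h0 : X t₀ = Y t₀) : EqOn X Y (Icc t₀ τ) := by
  obtain ⟨RX, hRX⟩ := isCompact_Icc.exists_bound_of_continuousOn hX.continuousOn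
  obtain ⟨RY, hRY⟩ := isCompact_Icc.exists_bound_of_continuousOn hY.continuousOn
  obtain ⟨K, hK⟩ := exists_lipschitzOnWith_slab hf τ (max RX RY)
  have hder : ∀ {Z : ℝ → E}, IsSolutionOn f (Icc t₀ τ) Z → ∀ t ∈ Ico t₀ τ,
      HasDerivWithinAt Z (f t (Z t)) (Ici t) t := fun hZ t ht =>
    (hZ t (Ico_subset_Icc_self ht)).mono_of_mem_nhdsWithin (Icc_mem_nhdsGE_of_mem ht)
  refine ODE_solution_unique_of_mem_Icc_right (K := K * 1)
    (s := fun _ => closedBall (0 : E) (max RX RY)) (fun t ht => ?_)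
    hX.continuousOn (hder hX) ?_ hY.continuousOn (hder hY) ?_ h0
  · refine hK.comp (f := fun z : E => (t, z)) (LipschitzWith.prodMk_left t).lipschitzOnWith ?_
    exact fun z hz => ⟨⟨ht₀.trans ht.1, ht.2.le⟩, hz⟩
  · exact fun t ht => mem_closedBall_zero_iff.2
      ((hRX t (Ico_subset_Icc_self ht)).trans (le_max_left _ _))
  · exact fun t ht => mem_closedBall_zero_iff.2
      ((hRY t (Ico_subset_Icc_self ht)).trans (le_max_right _ _))

theorem exists_solution_Ici
    (hf : LocallyLipschitzOn (Ici (0 : ℝ) ×ˢ (univ : Set E)) fun p : ℝ × E => f p.1 p.2)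
    {t₀ R : ℝ} (ht₀ : 0 ≤ t₀) {x₀ : E} (hx₀ : ‖x₀‖ ≤ R)
    (hR : ∀ (t₁ : ℝ) (X : ℝ → E), X t₀ = x₀ → IsSolutionOn f (Ico t₀ t₁) X →
      ∀ t ∈ Ico t₀ t₁, ‖X t‖ ≤ R) :
    ∃ X : ℝ → E, X t₀ = x₀ ∧ IsSolutionOn f (Ici t₀) X := by
  have hex : ∀ n : ℕ, ∃ X : ℝ → E, X t₀ = x₀ ∧ IsSolutionOn f (Icc t₀ (t₀ + (n + 1 : ℕ))) X :=
    fun n => exists_solution_Icc hf ht₀ (by simp; positivity) hx₀ hR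
  choose Y hY0 hY using hex
  have hagree : ∀ m n : ℕ, m ≤ n → EqOn (Y m) (Y n) (Icc t₀ (t₀ + (m + 1 : ℕ))) := by
    intro m n hmn
    refine eqOn_of_solutions hf ht₀ (hY m) ((hY n).mono (Icc_subset_Icc_right ?_))
      ((hY0 m).trans (hY0 n).symm)
    gcongr
  -- `Y n` lives up to t₀ + n + 1, so the piece selected at time t always extends strictly beyond t.
  set X : ℝ → E := fun t => Y ⌊t - t₀⌋₊ t with hX
  have hXY : ∀ n : ℕ, ∀ t ∈ Ico t₀ (t₀ + (n + 1 : ℕ)), X t = Y n t := by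
    intro n t ht
    have h1 : ⌊t - t₀⌋₊ ≤ n := by
      rw [← Nat.lt_succ_iff, Nat.floor_lt (by linarith [ht.1])]
      linarith [ht.2]
    refine hagree _ _ h1 ⟨ht.1, ?_⟩
    have := Nat.lt_floor_add_one (t - t₀)
    push_cast
    linarith
  refine ⟨X, ?_, fun t ht => ?_⟩
  · rw [hXY 0 t₀ ⟨le_rfl, by simp⟩, hY0]
  · set n := ⌊t - t₀⌋₊ with hn
    have htn : t ∈ Ico t₀ (t₀ + (n + 1 : ℕ)) := by
      refine ⟨ht, ?_⟩
      have := Nat.lt_floor_add_one (t - t₀)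
      push_cast
      linarith
    have hmem : Ico t₀ (t₀ + (n + 1 : ℕ)) ∈ 𝓝[Ici t₀] t := by
      rw [← Ici_inter_Iio]
      exact inter_mem self_mem_nhdsWithin (mem_nhdsWithin_of_mem_nhds (Iio_mem_nhds htn.2))
    have h1 := (hY n t (Ico_subset_Icc_self htn)).mono Ico_subset_Icc_self
    have h2 : HasDerivWithinAt X (f t (X t)) (Ico t₀ (t₀ + (n + 1 : ℕ))) t := by
      rw [hXY n t htn]
      exact h1.congr (fun s hs => hXY n s hs) (hXY n t htn)
    exact h2.mono_of_mem_nhdsWithin hmem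

end GlobalExistence

/-! ## Functions that are uniformly small on a sequence of windows -/

section Windows

variable {F F' : Type*} [NormedAddCommGroup F] [NormedAddCommGroup F']
  {a : ℕ → ℝ} {T : ℝ}

/-- `g n` tends to zero as `n → ∞`, uniformly on the windows `[a n, a n + T]`. -/
def UnifSmall (a : ℕ → ℝ) (T : ℝ) (g : ℕ → ℝ → F) : Prop :=
  ∀ ε : ℝ, 0 < ε → ∀ᶠ n in atTop, ∀ s ∈ Icc (a n) (a n + T), ‖g n s‖ ≤ ε

theorem UnifSmall.of_le {g : ℕ → ℝ → F} {h : ℕ → ℝ → F'} (hg : UnifSmall a T g) (c : ℝ)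
    (hh : ∀ n, ∀ s ∈ Icc (a n) (a n + T), ‖h n s‖ ≤ c * ‖g n s‖) : UnifSmall a T h := by
  intro ε hε
  filter_upwards [hg (ε / (|c| + 1)) (by positivity)] with n hn s hs
  calc ‖h n s‖ ≤ c * ‖g n s‖ := hh n s hs
    _ ≤ (|c| + 1) * (ε / (|c| + 1)) := by
      gcongr
      · linarith [le_abs_self c]
      · exact hn s hs
    _ = ε := by field_simp

theorem UnifSmall.add {g h : ℕ → ℝ → F} (hg : UnifSmall a T g) (hh : UnifSmall a T h) :
    UnifSmall a T fun n s => g n s + h n s := by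
  intro ε hε
  filter_upwards [hg (ε / 2) (by positivity), hh (ε / 2) (by positivity)] with n h1 h2 s hs
  exact (norm_add_le _ _).trans (by linarith [h1 s hs, h2 s hs])

theorem UnifSmall.sub {g h : ℕ → ℝ → F} (hg : UnifSmall a T g) (hh : UnifSmall a T h) :
    UnifSmall a T fun n s => g n s - h n s := by
  have : UnifSmall a T fun n s => -h n s := hh.of_le 1 fun n s _ => by simp
  simpa [sub_eq_add_neg] using hg.add this

theorem UnifSmall.oscillation_of_small {g : ℕ → ℝ → F} (hT : 0 ≤ T) (hg : UnifSmall a T g) :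
    UnifSmall a T fun n s => g n s - g n (a n) := by
  intro ε hε
  filter_upwards [hg (ε / 2) (by positivity)] with n hn s hs
  exact (norm_sub_le _ _).trans (by linarith [hn s hs, hn (a n) ⟨le_rfl, by linarith⟩])

variable [NormedSpace ℝ F]

/-- Over a subinterval of length h containing s, the increment of G is h g(s) up to an error K h²,
while the oscillation bounds it by 2η. -/
theorem norm_deriv_le_of_oscillation {G g : ℝ → F} {b K η h : ℝ} (h0 : 0 < h) (hT : 2 * h ≤ T)
    (hG : ∀ s ∈ Icc b (b + T), HasDerivWithinAt G (g s) (Icc b (b + T)) s)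
    (hg : ∀ s ∈ Icc b (b + T), ∀ s' ∈ Icc b (b + T), ‖g s - g s'‖ ≤ K * |s - s'|)
    (hosc : ∀ s ∈ Icc b (b + T), ‖G s - G b‖ ≤ η) :
    ∀ s ∈ Icc b (b + T), ‖g s‖ ≤ 2 * η / h + K * h := by
  intro s hs
  -- The subinterval starts at s if it fits in the window and ends at s otherwise.
  obtain ⟨c, hc, hcT, hcs, hsc⟩ : ∃ c, b ≤ c ∧ c + h ≤ b + T ∧ c ≤ s ∧ s ≤ c + h := by
    by_cases hsh : s + h ≤ b + T
    · exact ⟨s, hs.1, hsh, le_rfl, by linarith⟩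
    · exact ⟨s - h, by linarith, by linarith [hs.2], by linarith, by linarith⟩
  have hsub : Icc c (c + h) ⊆ Icc b (b + T) := Icc_subset_Icc hc hcT
  have hK : 0 ≤ K := by
    have := (norm_nonneg _).trans (hg b ⟨le_rfl, by linarith⟩ (b + h) ⟨by linarith, by linarith⟩)
    have h1 : |b - (b + h)| = h := by rw [sub_add_cancel_left, abs_neg, abs_of_pos h0]
    rw [h1] at this
    exact nonneg_of_mul_nonneg_left this h0
  have hder : ∀ τ ∈ Icc c (c + h),
      HasDerivWithinAt (fun τ => G τ - τ • g s) (g τ - g s) (Icc c (c + h)) τ := by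
    intro τ hτ
    have h1 := (hasDerivWithinAt_id τ (Icc c (c + h))).smul_const (g s)
    rw [one_smul] at h1
    exact ((hG τ (hsub hτ)).mono hsub).sub h1
  have hmv := norm_image_sub_le_of_norm_deriv_le_segment' hder (C := K * h) (fun τ hτ => by
    refine (hg τ (hsub (Ico_subset_Icc_self hτ)) s hs).trans ?_
    gcongr
    rw [abs_le]
    constructor <;> linarith [hτ.1, hτ.2]) (c + h) (right_mem_Icc.2 (by linarith))
  have hsplit : h • g s = (G (c + h) - G b) - (G c - G b)
      - ((G (c + h) - (c + h) • g s) - (G c - c • g s)) := by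
    rw [add_smul]; abel
  have hnorm : h * ‖g s‖ ≤ η + η + K * h * h := by
    rw [← Real.norm_of_nonneg h0.le, ← norm_smul, hsplit, Real.norm_of_nonneg h0.le]
    refine (norm_sub_le _ _).trans (add_le_add ((norm_sub_le _ _).trans (add_le_add ?_ ?_)) ?_)
    · exact hosc _ ⟨by linarith, hcT⟩
    · exact hosc _ ⟨hc, by linarith⟩
    · simpa using hmv
  have : ‖g s‖ ≤ (η + η + K * h * h) / h := by
    rw [le_div_iff₀ h0]; linarith
  refine this.trans_eq ?_
  field_simp
  ring

/-- A quantitative Barbalat lemma: fix h with K h ≤ ε/2, then wait until the oscillation is below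
εh/4. -/
theorem UnifSmall.deriv {G g : ℕ → ℝ → F} {K : ℝ} (hT : 0 < T)
    (hG : ∀ n, ∀ s ∈ Icc (a n) (a n + T),
      HasDerivWithinAt (G n) (g n s) (Icc (a n) (a n + T)) s)
    (hg : ∀ n, ∀ s ∈ Icc (a n) (a n + T), ∀ s' ∈ Icc (a n) (a n + T),
      ‖g n s - g n s'‖ ≤ K * |s - s'|)
    (hosc : UnifSmall a T fun n s => G n s - G n (a n)) : UnifSmall a T g := by
  intro ε hε
  set h := min (T / 2) (ε / (2 * (|K| + 1))) with hh
  have h0 : 0 < h := by positivity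
  filter_upwards [hosc (ε * h / 4) (by positivity)] with n hn s hs
  have h1 := norm_deriv_le_of_oscillation h0 (by linarith [min_le_left (T / 2) (ε / (2 * (|K| + 1)))])
    (hG n) (hg n) hn s hs
  have h2 : K * h ≤ ε / 2 := by
    calc K * h ≤ (|K| + 1) * (ε / (2 * (|K| + 1))) := by
          gcongr
          · linarith [le_abs_self K]
          · exact min_le_right _ _
      _ = ε / 2 := by field_simp
  have h3 : 2 * (ε * h / 4) / h = ε / 2 := by field_simp; norm_num
  linarith

theorem UnifSmall.oscillation {G g : ℕ → ℝ → F} (hT : 0 < T)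
    (hG : ∀ n, ∀ s ∈ Icc (a n) (a n + T),
      HasDerivWithinAt (G n) (g n s) (Icc (a n) (a n + T)) s)
    (hg : UnifSmall a T g) : UnifSmall a T fun n s => G n s - G n (a n) := by
  intro ε hε
  filter_upwards [hg (ε / T) (by positivity)] with n hn s hs
  refine (norm_image_sub_le_of_norm_deriv_le_segment' (hG n)
    (fun τ hτ => hn τ (Ico_subset_Icc_self hτ)) s hs).trans ?_
  calc ε / T * (s - a n) ≤ ε / T * T := by gcongr; linarith [hs.2]
    _ = ε := by field_simp

/-- The constant is chosen before the curve, which supplies the Lipschitz bound common to all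
windows in `UnifSmall.deriv`. -/
theorem exists_lipschitz_comp {Z : Type*} [NormedAddCommGroup Z] [NormedSpace ℝ Z]
    [FiniteDimensional ℝ Z] {Ψ : Z → F} (hΨ : ContDiff ℝ 1 Ψ) (R K : ℝ) :
    ∃ K' : ℝ, ∀ (I : Set ℝ) (z : ℝ → Z), (∀ s ∈ I, ‖z s‖ ≤ R) →
      (∀ s ∈ I, ∀ s' ∈ I, ‖z s - z s'‖ ≤ K * |s - s'|) →
      ∀ s ∈ I, ∀ s' ∈ I, ‖Ψ (z s) - Ψ (z s')‖ ≤ K' * |s - s'| := by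
  have : ProperSpace Z := FiniteDimensional.proper ℝ Z
  obtain ⟨C, hC⟩ := LocallyLipschitzOn.exists_lipschitzOnWith_of_compact
    (isCompact_closedBall (0 : Z) R) hΨ.locallyLipschitz.locallyLipschitzOn
  refine ⟨C * K, fun I z hz hl s hs s' hs' => ?_⟩
  have := hC.dist_le_mul (z s) (by simpa using hz s hs) (z s') (by simpa using hz s' hs')
  rw [dist_eq_norm, dist_eq_norm] at this
  rw [mul_assoc]
  exact this.trans (by gcongr; exact hl s hs s' hs')

/-- Variation of constants: the derivative of exp(s - b) z(s) is exp(s - b) v(s). -/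
theorem norm_le_of_hasDerivWithinAt_neg_add {z v : ℝ → F} {b t c : ℝ} (hbt : b ≤ t)
    (hz : ∀ s ∈ Icc b t, HasDerivWithinAt z (-z s + v s) (Icc b t) s)
    (hv : ∀ s ∈ Icc b t, ‖v s‖ ≤ c) : ‖z t‖ ≤ Real.exp (-(t - b)) * ‖z b‖ + c := by
  have hc : 0 ≤ c := (norm_nonneg _).trans (hv b ⟨le_rfl, hbt⟩)
  have hder : ∀ s ∈ Icc b t, HasDerivWithinAt (fun s => Real.exp (s - b) • z s)
      (Real.exp (s - b) • v s) (Icc b t) s := by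
    intro s hs
    have h1 : HasDerivWithinAt (fun s => Real.exp (s - b)) (Real.exp (s - b)) (Icc b t) s := by
      simpa using (((hasDerivAt_id s).sub_const b).exp).hasDerivWithinAt
    convert! h1.smul (hz s hs) using 1
    rw [smul_add, smul_neg]
    abel
  have hB : ∀ s, HasDerivAt (fun s => ‖z b‖ + c * (Real.exp (s - b) - 1))
      (c * Real.exp (s - b)) s := by
    intro s
    simpa using ((((hasDerivAt_id s).sub_const b).exp.sub_const 1).const_mul c).const_add ‖z b‖
  have h1 := image_norm_le_of_norm_deriv_right_le_deriv_boundary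
    (fun s hs => (hder s hs).continuousWithinAt)
    (fun s hs => (hder s (Ico_subset_Icc_self hs)).mono_of_mem_nhdsWithin
      (Icc_mem_nhdsGE_of_mem hs))
    (B := fun s => ‖z b‖ + c * (Real.exp (s - b) - 1)) (by simp) hB
    (fun s hs => by
      rw [norm_smul, Real.norm_of_nonneg (Real.exp_pos _).le, mul_comm]
      gcongr
      exact hv s (Ico_subset_Icc_self hs)) (right_mem_Icc.2 hbt)
  rw [norm_smul, Real.norm_of_nonneg (Real.exp_pos _).le] at h1
  have hE : Real.exp (-(t - b)) * Real.exp (t - b) = 1 := by rw [← Real.exp_add]; simp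
  have h2 := mul_le_mul_of_nonneg_left h1 (Real.exp_pos (-(t - b))).le
  rw [← mul_assoc, hE, one_mul] at h2
  have h3 : Real.exp (-(t - b)) * (‖z b‖ + c * (Real.exp (t - b) - 1))
      = Real.exp (-(t - b)) * ‖z b‖ + c - c * Real.exp (-(t - b)) := by
    linear_combination c * hE
  have : 0 ≤ c * Real.exp (-(t - b)) := by positivity
  linarith

/-- Pigeonhole: the n + 1 decrements telescope to at most c. -/
theorem exists_small_decrement {V : ℕ → ℝ} {c : ℝ} (h0 : V 0 ≤ c) (hV : ∀ n, 0 ≤ V n) (n : ℕ) :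
    ∃ k ≤ n, V k - V (k + 1) ≤ c / (n + 1) := by
  have hsum : ∑ k ∈ Finset.range (n + 1), (V k - V (k + 1))
      ≤ ∑ _k ∈ Finset.range (n + 1), c / ((n : ℝ) + 1) := by
    rw [Finset.sum_range_sub', Finset.sum_const, Finset.card_range, nsmul_eq_mul]
    push_cast
    rw [mul_div_cancel₀ _ (by positivity)]
    linarith [hV (n + 1)]
  obtain ⟨k, hk, hle⟩ := Finset.exists_le_of_sum_le ⟨0, by simp⟩ hsum
  exact ⟨k, Nat.lt_succ_iff.mp (Finset.mem_range.mp hk), hle⟩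

end Windows

/-! ## Adaptive loops on Hilbert spaces -/

section LocallyLipschitz

theorem _root_.LocallyLipschitzOn.prodMk {α β γ : Type*} [PseudoEMetricSpace α] [PseudoEMetricSpace β]
    [PseudoEMetricSpace γ] {s : Set α} {f : α → β} {g : α → γ} (hf : LocallyLipschitzOn s f)
    (hg : LocallyLipschitzOn s g) : LocallyLipschitzOn s fun x => (f x, g x) := by
  intro x hx
  obtain ⟨Kf, t, ht, hft⟩ := hf hx
  obtain ⟨Kg, u, hu, hgu⟩ := hg hx
  exact ⟨max Kf Kg, t ∩ u, inter_mem ht hu,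
    (hft.mono inter_subset_left).prodMk (hgu.mono inter_subset_right)⟩

theorem _root_.LocallyLipschitzOn.comp_mapsTo {α β γ : Type*} [PseudoEMetricSpace α]
    [PseudoEMetricSpace β] [PseudoEMetricSpace γ] {s : Set α} {t : Set β} {f : β → γ} {g : α → β}
    (hf : LocallyLipschitzOn t f) (hg : LocallyLipschitzOn s g) (hm : MapsTo g s t) :
    LocallyLipschitzOn s (f ∘ g) := by
  intro x hx
  obtain ⟨Kg, u, hu, hgu⟩ := hg hx
  obtain ⟨Kf, v, hv, hfv⟩ := hf (hm hx)
  have hgv : g ⁻¹' v ∈ 𝓝[s] x :=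
    (hg.continuousOn x hx).tendsto_nhdsWithin hm hv
  exact ⟨Kf * Kg, u ∩ g ⁻¹' v, inter_mem hu hgv,
    hfv.comp (hgu.mono inter_subset_left) fun y hy => hy.2⟩

end LocallyLipschitz

section AdaptiveLoop

variable {E₁ E₂ : Type*} [NormedAddCommGroup E₁] [InnerProductSpace ℝ E₁]
  [NormedAddCommGroup E₂] [InnerProductSpace ℝ E₂]

/-- The right-hand side of an adaptive loop with state `X = ((x, w), z)` and input `u`. -/
def loopRHS (A : E₁ →L[ℝ] E₁) (B : E₂ →L[ℝ] E₁ →L[ℝ] E₁) (C : E₁ →L[ℝ] E₁ →L[ℝ] E₂)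
    (p : WithLp 2 (WithLp 2 (E₁ × E₂) × E₁) × E₁) : WithLp 2 (WithLp 2 (E₁ × E₂) × E₁) :=
  WithLp.toLp 2 (WithLp.toLp 2 (-A p.1.fst.fst - B p.1.fst.snd p.1.snd, C p.1.snd p.1.fst.fst),
    -p.1.snd + p.2)

/-- The adaptive loop `x' = -A x - B w z`, `w' = C z x`, `z' = -z + φ(t, (x, w))`. -/
def loopField (A : E₁ →L[ℝ] E₁) (B : E₂ →L[ℝ] E₁ →L[ℝ] E₁) (C : E₁ →L[ℝ] E₁ →L[ℝ] E₂)
    (φ : ℝ → WithLp 2 (E₁ × E₂) → E₁) (t : ℝ) (X : WithLp 2 (WithLp 2 (E₁ × E₂) × E₁)) :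
    WithLp 2 (WithLp 2 (E₁ × E₂) × E₁) :=
  loopRHS A B C (X, φ t X.fst)

/-- The standing assumptions on an adaptive loop. -/
structure IsAdaptiveLoop (A : E₁ →L[ℝ] E₁) (B : E₂ →L[ℝ] E₁ →L[ℝ] E₁)
    (C : E₁ →L[ℝ] E₁ →L[ℝ] E₂) (φ : ℝ → WithLp 2 (E₁ × E₂) → E₁) (ρ : ℝ → ℝ) (α : ℝ) : Prop where
  lip : LocallyLipschitzOn (Ici (0 : ℝ) ×ˢ (univ : Set (WithLp 2 (E₁ × E₂))))
    fun p : ℝ × WithLp 2 (E₁ × E₂) => φ p.1 p.2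
  growth : GrowthBound φ ρ
  pos : 0 < α
  coercive : ∀ x, α * ‖x‖ ^ 2 ≤ inner ℝ x (A x)
  adjoint : ∀ x w z, inner ℝ x (B w z) = inner ℝ w (C z x)

/-- Persistency of excitation of `φ` as seen through `B`, along the solutions of `f`. -/
def IsExcitedAlong (B : E₂ →L[ℝ] E₁ →L[ℝ] E₁) (φ : ℝ → WithLp 2 (E₁ × E₂) → E₁)
    (f : ℝ → WithLp 2 (WithLp 2 (E₁ × E₂) × E₁) → WithLp 2 (WithLp 2 (E₁ × E₂) × E₁)) : Prop :=
  ∀ r δ : ℝ, 0 < r → 0 < δ → ∃ T μ : ℝ, 0 < T ∧ 0 < μ ∧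
    ∀ t₀ : ℝ, 0 ≤ t₀ → ∀ X : ℝ → WithLp 2 (WithLp 2 (E₁ × E₂) × E₁),
      ‖X t₀‖ < r → IsSolutionOn f (Ici t₀) X →
      ∀ t : ℝ, t₀ ≤ t → (∀ s ∈ Icc t (t + T), δ ≤ ‖(X s).fst‖) →
        ∀ (w : E₂) (η : ℝ), (∀ s ∈ Icc t (t + T), ‖B w (φ s (X s).fst)‖ ≤ η) → μ * ‖w‖ ≤ η

theorem norm_fst_le {E₁ E₂ : Type*} [NormedAddCommGroup E₁] [NormedAddCommGroup E₂]
    (x : WithLp 2 (E₁ × E₂)) : ‖x.fst‖ ≤ ‖x‖ := by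
  refine le_of_sq_le_sq ?_ (norm_nonneg _)
  rw [WithLp.prod_norm_sq_eq_of_L2]
  nlinarith [sq_nonneg ‖x.snd‖]

theorem norm_snd_le {E₁ E₂ : Type*} [NormedAddCommGroup E₁] [NormedAddCommGroup E₂]
    (x : WithLp 2 (E₁ × E₂)) : ‖x.snd‖ ≤ ‖x‖ := by
  refine le_of_sq_le_sq ?_ (norm_nonneg _)
  rw [WithLp.prod_norm_sq_eq_of_L2]
  nlinarith [sq_nonneg ‖x.fst‖]

theorem norm_le_fst_add_snd {E₁ E₂ : Type*} [NormedAddCommGroup E₁] [NormedAddCommGroup E₂]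
    (x : WithLp 2 (E₁ × E₂)) : ‖x‖ ≤ ‖x.fst‖ + ‖x.snd‖ := by
  refine le_of_sq_le_sq ?_ (by positivity)
  rw [WithLp.prod_norm_sq_eq_of_L2]
  nlinarith [norm_nonneg x.fst, norm_nonneg x.snd]

theorem _root_.HasDerivWithinAt.withLp_fst {X : ℝ → WithLp 2 (E₁ × E₂)} {X' : WithLp 2 (E₁ × E₂)}
    {J : Set ℝ} {t : ℝ} (h : HasDerivWithinAt X X' J t) :
    HasDerivWithinAt (fun s => (X s).fst) X'.fst J t :=
  (WithLp.fstL 2 ℝ E₁ E₂).hasFDerivAt.comp_hasDerivWithinAt t h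

theorem _root_.HasDerivWithinAt.withLp_snd {X : ℝ → WithLp 2 (E₁ × E₂)} {X' : WithLp 2 (E₁ × E₂)}
    {J : Set ℝ} {t : ℝ} (h : HasDerivWithinAt X X' J t) :
    HasDerivWithinAt (fun s => (X s).snd) X'.snd J t :=
  (WithLp.sndL 2 ℝ E₁ E₂).hasFDerivAt.comp_hasDerivWithinAt t h

theorem _root_.HasDerivWithinAt.withLp_mk {x : ℝ → E₁} {y : ℝ → E₂} {x' : E₁} {y' : E₂}
    {J : Set ℝ} {t : ℝ} (hx : HasDerivWithinAt x x' J t) (hy : HasDerivWithinAt y y' J t) :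
    HasDerivWithinAt (fun s => WithLp.toLp 2 (x s, y s)) (WithLp.toLp 2 (x', y')) J t :=
  (WithLp.prodContinuousLinearEquiv 2 ℝ E₁ E₂).symm.hasFDerivAt.comp_hasDerivWithinAt t
    (hx.prodMk hy)

theorem _root_.ContDiff.withLp_fst {Z : Type*} [NormedAddCommGroup Z] [NormedSpace ℝ Z]
    {g : Z → WithLp 2 (E₁ × E₂)} {n : WithTop ℕ∞} (h : ContDiff ℝ n g) :
    ContDiff ℝ n fun z => (g z).fst :=
  (WithLp.fstL 2 ℝ E₁ E₂).contDiff.comp h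

theorem _root_.ContDiff.withLp_snd {Z : Type*} [NormedAddCommGroup Z] [NormedSpace ℝ Z]
    {g : Z → WithLp 2 (E₁ × E₂)} {n : WithTop ℕ∞} (h : ContDiff ℝ n g) :
    ContDiff ℝ n fun z => (g z).snd :=
  (WithLp.sndL 2 ℝ E₁ E₂).contDiff.comp h

variable {A : E₁ →L[ℝ] E₁} {B : E₂ →L[ℝ] E₁ →L[ℝ] E₁} {C : E₁ →L[ℝ] E₁ →L[ℝ] E₂}
  {φ : ℝ → WithLp 2 (E₁ × E₂) → E₁} {ρ : ℝ → ℝ} {α : ℝ}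

/-- Treating the input as an independent variable keeps the right-hand side smooth; the merely
Lipschitz φ enters only through the curve s ↦ φ(s, ξ(s)). -/
theorem contDiff_loopRHS : ContDiff ℝ 1 (loopRHS A B C) := by
  have hX : ContDiff ℝ 1 fun p : WithLp 2 (WithLp 2 (E₁ × E₂) × E₁) × E₁ => p.1 := contDiff_fst
  have hx := hX.withLp_fst.withLp_fst
  have hw := hX.withLp_fst.withLp_snd
  have hz := hX.withLp_snd
  refine WithLp.contDiff_toLp.comp (ContDiff.prodMk (WithLp.contDiff_toLp.comp
    (ContDiff.prodMk ?_ ?_)) (hz.neg.add contDiff_snd))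
  · exact (A.contDiff.comp hx).neg.sub ((B.contDiff.comp hw).clm_apply hz)
  · exact (C.contDiff.comp hz).clm_apply hx

theorem locallyLipschitzOn_loopField
    (hφ : LocallyLipschitzOn (Ici (0 : ℝ) ×ˢ (univ : Set (WithLp 2 (E₁ × E₂))))
      fun p : ℝ × WithLp 2 (E₁ × E₂) => φ p.1 p.2) :
    LocallyLipschitzOn (Ici (0 : ℝ) ×ˢ (univ : Set (WithLp 2 (WithLp 2 (E₁ × E₂) × E₁))))
      fun p : ℝ × WithLp 2 (WithLp 2 (E₁ × E₂) × E₁) => loopField A B C φ p.1 p.2 := by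
  have h1 : LocallyLipschitz
      fun p : ℝ × WithLp 2 (WithLp 2 (E₁ × E₂) × E₁) => (p.1, p.2.fst) := by
    have : ContDiff ℝ 1 fun p : ℝ × WithLp 2 (WithLp 2 (E₁ × E₂) × E₁) => (p.1, p.2.fst) :=
      contDiff_fst.prodMk contDiff_snd.withLp_fst
    exact this.locallyLipschitz
  have h2 := LocallyLipschitzOn.comp_mapsTo (s := Ici (0 : ℝ) ×ˢ
    (univ : Set (WithLp 2 (WithLp 2 (E₁ × E₂) × E₁)))) hφ h1.locallyLipschitzOn
    fun p hp => ⟨hp.1, mem_univ _⟩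
  have h3 : LocallyLipschitz fun p : ℝ × WithLp 2 (WithLp 2 (E₁ × E₂) × E₁) => p.2 :=
    LipschitzWith.prod_snd.locallyLipschitz
  exact LocallyLipschitzOn.comp_mapsTo (t := univ)
    (contDiff_loopRHS (A := A) (B := B) (C := C)).locallyLipschitz.locallyLipschitzOn
    (LocallyLipschitzOn.prodMk h3.locallyLipschitzOn h2) (mapsTo_univ _ _)

namespace IsAdaptiveLoop

variable {J : Set ℝ} {X : ℝ → WithLp 2 (WithLp 2 (E₁ × E₂) × E₁)}

/-- Adjointness cancels the terms in B and C, leaving only the dissipation through A. -/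
theorem hasDerivWithinAt_norm_sq (h : IsAdaptiveLoop A B C φ ρ α)
    (hX : IsSolutionOn (loopField A B C φ) J X) {t : ℝ} (ht : t ∈ J) :
    HasDerivWithinAt (fun s => ‖(X s).fst‖ ^ 2)
      (-2 * inner ℝ (X t).fst.fst (A (X t).fst.fst)) J t := by
  have hinner : inner ℝ (X t).fst (loopField A B C φ t (X t)).fst
      = inner ℝ (X t).fst.fst (-A (X t).fst.fst - B (X t).fst.snd (X t).snd)
        + inner ℝ (X t).fst.snd (C (X t).snd (X t).fst.fst) := WithLp.prod_inner_apply _ _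
  convert! (hX t ht).withLp_fst.norm_sq using 1
  rw [hinner, inner_sub_right, inner_neg_right, h.adjoint]
  ring

theorem antitoneOn_norm (h : IsAdaptiveLoop A B C φ ρ α) (hJ : Convex ℝ J)
    (hX : IsSolutionOn (loopField A B C φ) J X) : AntitoneOn (fun s => ‖(X s).fst‖) J := by
  have h2 : AntitoneOn (fun s => ‖(X s).fst‖ ^ 2) J := by
    have hd : ∀ t ∈ interior J, HasDerivAt (fun s => ‖(X s).fst‖ ^ 2)
        (-2 * inner ℝ (X t).fst.fst (A (X t).fst.fst)) t := fun t ht =>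
      (h.hasDerivWithinAt_norm_sq hX (interior_subset ht)).hasDerivAt (mem_interior_iff_mem_nhds.1 ht)
    refine antitoneOn_of_deriv_nonpos hJ
      (fun t ht => (h.hasDerivWithinAt_norm_sq hX ht).continuousWithinAt)
      (fun t ht => (hd t ht).differentiableAt.differentiableWithinAt) fun t ht => ?_
    rw [(hd t ht).deriv]
    nlinarith [h.coercive (X t).fst.fst, h.pos, sq_nonneg ‖(X t).fst.fst‖]
  intro s hs t ht hst
  exact le_of_sq_le_sq (h2 hs ht hst) (norm_nonneg _)

theorem norm_snd_le_of_bound (_h : IsAdaptiveLoop A B C φ ρ α) {b t c : ℝ} (hbt : b ≤ t)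
    (hJ : Icc b t ⊆ J) (hX : IsSolutionOn (loopField A B C φ) J X)
    (hc : ∀ s ∈ Icc b t, ‖φ s (X s).fst‖ ≤ c) :
    ‖(X t).snd‖ ≤ Real.exp (-(t - b)) * ‖(X b).snd‖ + c :=
  norm_le_of_hasDerivWithinAt_neg_add hbt
    (fun s hs => ((hX s (hJ hs)).mono hJ).withLp_snd) hc

theorem rho_mono (h : IsAdaptiveLoop A B C φ ρ α) {s t : ℝ} (hs : 0 ≤ s) (hst : s ≤ t) :
    ρ s ≤ ρ t :=
  h.growth.monotoneOn hs (hs.trans hst) hst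

theorem norm_input_le (h : IsAdaptiveLoop A B C φ ρ α) {t r : ℝ} (ht : 0 ≤ t)
    {ξ : WithLp 2 (E₁ × E₂)} (hξ : ‖ξ‖ ≤ r) : ‖φ t ξ‖ ≤ ρ r :=
  (h.growth.norm_le h.lip ht ξ).trans (h.rho_mono (norm_nonneg _) hξ)

theorem norm_snd_le (h : IsAdaptiveLoop A B C φ ρ α) (hJ : Convex ℝ J) {b t : ℝ} (hb : 0 ≤ b)
    (hbJ : b ∈ J) (htJ : t ∈ J) (hbt : b ≤ t) (hX : IsSolutionOn (loopField A B C φ) J X) :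
    ‖(X t).snd‖ ≤ ‖(X b).snd‖ + ρ ‖(X b).fst‖ := by
  have hsub : Icc b t ⊆ J := hJ.ordConnected.out hbJ htJ
  refine (h.norm_snd_le_of_bound hbt hsub hX (c := ρ ‖(X b).fst‖) fun s hs => ?_).trans ?_
  · exact h.norm_input_le (hb.trans hs.1) (h.antitoneOn_norm hJ hX hbJ (hsub hs) hs.1)
  · gcongr
    refine mul_le_of_le_one_left (norm_nonneg _) (Real.exp_le_one_iff.2 ?_)
    linarith

theorem norm_le (h : IsAdaptiveLoop A B C φ ρ α) (hJ : Convex ℝ J) {b t : ℝ} (hb : 0 ≤ b)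
    (hbJ : b ∈ J) (htJ : t ∈ J) (hbt : b ≤ t) (hX : IsSolutionOn (loopField A B C φ) J X) :
    ‖X t‖ ≤ 2 * ‖X b‖ + ρ ‖X b‖ := by
  have h1 := h.norm_snd_le hJ hb hbJ htJ hbt hX
  have h2 : ‖(X t).fst‖ ≤ ‖(X b).fst‖ := h.antitoneOn_norm hJ hX hbJ htJ hbt
  have h3 := norm_le_fst_add_snd (X t)
  have h4 := norm_fst_le (X b)
  have h5 := SignedNetwork.norm_snd_le (X b)
  have h6 := h.rho_mono (norm_nonneg _) h4
  linarith

variable [FiniteDimensional ℝ E₁] [FiniteDimensional ℝ E₂]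

theorem complete (h : IsAdaptiveLoop A B C φ ρ α) {t₀ : ℝ} (ht₀ : 0 ≤ t₀)
    (x₀ : WithLp 2 (WithLp 2 (E₁ × E₂) × E₁)) :
    ∃ X, X t₀ = x₀ ∧ IsSolutionOn (loopField A B C φ) (Ici t₀) X := by
  have hlip := locallyLipschitzOn_loopField (A := A) (B := B) (C := C) h.lip
  refine exists_solution_Ici (f := loopField A B C φ) (R := 2 * ‖x₀‖ + ρ ‖x₀‖) ?_ ht₀ ?_ ?_
  · exact hlip
  · linarith [norm_nonneg x₀, h.growth.nonneg _ (norm_nonneg x₀)]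
  · intro t₁ X hX0 hX t ht
    rw [← hX0]
    exact h.norm_le (convex_Ico _ _) ht₀ ⟨le_rfl, ht.1.trans_lt ht.2⟩ ht ht.1 hX

end IsAdaptiveLoop

end AdaptiveLoop

/-! ### Attractivity from windows of small dissipation -/

section Attractivity

open Metric

variable {E₁ E₂ : Type*} [NormedAddCommGroup E₁] [InnerProductSpace ℝ E₁]
  [NormedAddCommGroup E₂] [InnerProductSpace ℝ E₂] [FiniteDimensional ℝ E₁]
  [FiniteDimensional ℝ E₂]
  {A : E₁ →L[ℝ] E₁} {B : E₂ →L[ℝ] E₁ →L[ℝ] E₁} {C : E₁ →L[ℝ] E₁ →L[ℝ] E₂}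
  {φ : ℝ → WithLp 2 (E₁ × E₂) → E₁} {ρ : ℝ → ℝ} {α : ℝ}

namespace IsAdaptiveLoop

/-- R and K depend only on r, not on the initial time or the solution; all later uniformity rests on
this. -/
theorem exists_bounds (h : IsAdaptiveLoop A B C φ ρ α) (r : ℝ) : ∃ R K : ℝ,
    ∀ t₀ : ℝ, 0 ≤ t₀ → ∀ X : ℝ → WithLp 2 (WithLp 2 (E₁ × E₂) × E₁),
      IsSolutionOn (loopField A B C φ) (Ici t₀) X → ‖X t₀‖ < r →
      (∀ s ∈ Ici t₀, ‖(X s, φ s (X s).fst)‖ ≤ R) ∧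
      ∀ s ∈ Ici t₀, ∀ s' ∈ Ici t₀,
        ‖(X s, φ s (X s).fst) - (X s', φ s' (X s').fst)‖ ≤ K * |s - s'| := by
  have : ProperSpace (WithLp 2 (WithLp 2 (E₁ × E₂) × E₁) × E₁) := FiniteDimensional.proper ℝ _
  set R := 2 * r + ρ r with hR
  obtain ⟨K₀, hK₀⟩ := (isCompact_closedBall (0 : WithLp 2 (WithLp 2 (E₁ × E₂) × E₁) × E₁)
    R).exists_bound_of_continuousOn (contDiff_loopRHS (A := A) (B := B) (C := C)).continuous.continuousOn
  refine ⟨R, |K₀| + ρ r * (1 + |K₀|), fun t₀ ht₀ X hX hr => ?_⟩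
  have hr0 : 0 ≤ r := (norm_nonneg _).trans hr.le
  have hρ0 : 0 ≤ ρ r := h.growth.nonneg r hr0
  have hξ : ∀ s ∈ Ici t₀, ‖(X s).fst‖ < r := fun s hs =>
    ((h.antitoneOn_norm (convex_Ici _) hX self_mem_Ici hs hs).trans (norm_fst_le _)).trans_lt hr
  have hbound : ∀ s ∈ Ici t₀, ‖(X s, φ s (X s).fst)‖ ≤ R := by
    intro s hs
    have h1 := h.norm_le (convex_Ici _) ht₀ self_mem_Ici hs hs hX
    have h2 := h.rho_mono (norm_nonneg (X t₀)) hr.le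
    have h3 := h.norm_input_le (ht₀.trans hs) (hξ s hs).le
    rw [Prod.norm_def]
    exact max_le (by simp only; linarith) (by simp only; linarith)
  have hlipX : ∀ s ∈ Ici t₀, ∀ s' ∈ Ici t₀, ‖X s - X s'‖ ≤ |K₀| * |s - s'| := by
    intro s hs s' hs'
    refine (convex_Ici t₀).norm_image_sub_le_of_norm_hasDerivWithin_le hX (fun u hu => ?_) hs' hs
    exact (hK₀ _ (by simpa using hbound u hu)).trans (le_abs_self _)
  refine ⟨hbound, fun s hs s' hs' => ?_⟩
  have hX' := hlipX s hs s' hs'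
  have hfst : ‖(X s).fst - (X s').fst‖ ≤ |K₀| * |s - s'| := by
    have := norm_fst_le (X s - X s')
    rw [WithLp.sub_fst] at this
    exact this.trans hX'
  have h1 := h.growth.norm_sub_time_le h.lip (ht₀.trans hs') (ht₀.trans hs) (X s).fst
  have h2 := h.growth.norm_sub_le h.lip (ht₀.trans hs') (hξ s' hs') (hξ s hs)
  have h3 : ρ ‖(X s).fst‖ ≤ ρ r := h.rho_mono (norm_nonneg _) (hξ s hs).le
  have h4 : ‖φ s (X s).fst - φ s' (X s').fst‖ ≤ ρ r * (1 + |K₀|) * |s - s'| := by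
    calc ‖φ s (X s).fst - φ s' (X s').fst‖
        ≤ ‖φ s (X s).fst - φ s' (X s).fst‖ + ‖φ s' (X s).fst - φ s' (X s').fst‖ :=
          norm_sub_le_norm_sub_add_norm_sub _ _ _
      _ ≤ ρ r * |s - s'| + ρ r * (|K₀| * |s - s'|) := by
          refine add_le_add (h1.trans ?_) (h2.trans ?_) <;> gcongr
      _ = ρ r * (1 + |K₀|) * |s - s'| := by ring
  rw [Prod.mk_sub_mk, Prod.norm_def]
  have hs0 := abs_nonneg (s - s')
  have hK0 := abs_nonneg K₀
  have h5 : 0 ≤ ρ r * (1 + |K₀|) * |s - s'| := by positivity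
  have h6 : 0 ≤ |K₀| * |s - s'| := by positivity
  exact max_le (by simp only; linarith) (by simp only; linarith)

/-- Small dissipation propagates through the equations: coercivity gives x, the first equation gives
B(w)z, and differentiating B(w)z gives B(w)φ, because w' = C(z)x is already small. The same
smallness of w' lets w be frozen at the left end of the window. -/
theorem unifSmall_windows (h : IsAdaptiveLoop A B C φ ρ α) {r T : ℝ} (hT : 0 < T)
    {t₀ a : ℕ → ℝ} {X : ℕ → ℝ → WithLp 2 (WithLp 2 (E₁ × E₂) × E₁)} (ht₀ : ∀ n, 0 ≤ t₀ n)
    (hX : ∀ n, IsSolutionOn (loopField A B C φ) (Ici (t₀ n)) (X n))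
    (hr : ∀ n, ‖X n (t₀ n)‖ < r) (ha : ∀ n, t₀ n ≤ a n)
    (hdrop : ∀ ε : ℝ, 0 < ε → ∀ᶠ n in atTop,
      ‖(X n (a n)).fst‖ ^ 2 - ‖(X n (a n + T)).fst‖ ^ 2 ≤ ε) :
    UnifSmall a T (fun n s => (X n s).fst.fst) ∧
      UnifSmall a T fun n s => B (X n (a n)).fst.snd (φ s (X n s).fst) := by
  obtain ⟨R, K, hRK⟩ := h.exists_bounds r
  have hsub : ∀ n, Icc (a n) (a n + T) ⊆ Ici (t₀ n) := fun n s hs => (ha n).trans hs.1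
  set Z : ℕ → ℝ → WithLp 2 (WithLp 2 (E₁ × E₂) × E₁) × E₁ := fun n s => (X n s, φ s (X n s).fst)
  have hZR : ∀ n, ∀ s ∈ Icc (a n) (a n + T), ‖Z n s‖ ≤ R := fun n s hs =>
    (hRK _ (ht₀ n) _ (hX n) (hr n)).1 s (hsub n hs)
  have hZK : ∀ n, ∀ s ∈ Icc (a n) (a n + T), ∀ s' ∈ Icc (a n) (a n + T),
      ‖Z n s - Z n s'‖ ≤ K * |s - s'| := fun n s hs s' hs' =>
    (hRK _ (ht₀ n) _ (hX n) (hr n)).2 s (hsub n hs) s' (hsub n hs')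
  have hXR : ∀ n, ∀ s ∈ Icc (a n) (a n + T), ‖X n s‖ ≤ R := fun n s hs =>
    (_root_.norm_fst_le (Z n s)).trans (hZR n s hs)
  have hφR : ∀ n, ∀ s ∈ Icc (a n) (a n + T), ‖φ s (X n s).fst‖ ≤ R := fun n s hs =>
    (_root_.norm_snd_le (Z n s)).trans (hZR n s hs)
  have hzR : ∀ n, ∀ s ∈ Icc (a n) (a n + T), ‖(X n s).snd‖ ≤ R := fun n s hs =>
    (SignedNetwork.norm_snd_le _).trans (hXR n s hs)
  have hder : ∀ n, ∀ s ∈ Icc (a n) (a n + T),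
      HasDerivWithinAt (X n) (loopRHS A B C (Z n s)) (Icc (a n) (a n + T)) s := fun n s hs =>
    (hX n s (hsub n hs)).mono (hsub n)
  have hdx : ∀ n, ∀ s ∈ Icc (a n) (a n + T), HasDerivWithinAt (fun s => (X n s).fst.fst)
      (-A (X n s).fst.fst - B (X n s).fst.snd (X n s).snd) (Icc (a n) (a n + T)) s :=
    fun n s hs => (hder n s hs).withLp_fst.withLp_fst
  have hdw : ∀ n, ∀ s ∈ Icc (a n) (a n + T), HasDerivWithinAt (fun s => (X n s).fst.snd)
      (C (X n s).snd (X n s).fst.fst) (Icc (a n) (a n + T)) s :=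
    fun n s hs => (hder n s hs).withLp_fst.withLp_snd
  have hdz : ∀ n, ∀ s ∈ Icc (a n) (a n + T), HasDerivWithinAt (fun s => (X n s).snd)
      (-(X n s).snd + φ s (X n s).fst) (Icc (a n) (a n + T)) s :=
    fun n s hs => (hder n s hs).withLp_snd
  -- smoothness of the coordinates as functions of `Z`
  have cX : ContDiff ℝ 1 fun p : WithLp 2 (WithLp 2 (E₁ × E₂) × E₁) × E₁ => p.1 := contDiff_fst
  have cu : ContDiff ℝ 1 fun p : WithLp 2 (WithLp 2 (E₁ × E₂) × E₁) × E₁ => p.2 := contDiff_snd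
  have cx := cX.withLp_fst.withLp_fst
  have cw := cX.withLp_fst.withLp_snd
  have cz := cX.withLp_snd
  have cB : ∀ {f : WithLp 2 (WithLp 2 (E₁ × E₂) × E₁) × E₁ → E₂}
      {g : WithLp 2 (WithLp 2 (E₁ × E₂) × E₁) × E₁ → E₁}, ContDiff ℝ 1 f → ContDiff ℝ 1 g →
      ContDiff ℝ 1 fun p => B (f p) (g p) := fun hf hg => (B.contDiff.comp hf).clm_apply hg
  have cC := (C.contDiff.comp cz).clm_apply cx
  -- `x` is small, from the dissipation
  have small_x : UnifSmall a T fun n s => (X n s).fst.fst := by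
    obtain ⟨K₁, hK₁⟩ := exists_lipschitz_comp
      (contDiff_const (c := (-2 : ℝ)) |>.mul (cx.inner ℝ (A.contDiff.comp cx))) R K
    have hosc : UnifSmall a T fun n s => ‖(X n s).fst‖ ^ 2 - ‖(X n (a n)).fst‖ ^ 2 := by
      intro ε hε
      filter_upwards [hdrop ε hε] with n hn s hs
      have hanti := h.antitoneOn_norm (convex_Ici _) (hX n)
      have h1 : ‖(X n s).fst‖ ≤ ‖(X n (a n)).fst‖ := hanti (ha n) (hsub n hs) hs.1
      have h2 : ‖(X n (a n + T)).fst‖ ≤ ‖(X n s).fst‖ :=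
        hanti (hsub n hs) (hsub n (right_mem_Icc.2 (by linarith))) hs.2
      have h3 := pow_le_pow_left₀ (norm_nonneg _) h1 2
      have h4 := pow_le_pow_left₀ (norm_nonneg _) h2 2
      rw [Real.norm_eq_abs, abs_le]
      constructor <;> linarith
    have hsm := UnifSmall.deriv hT
      (fun n s hs => (h.hasDerivWithinAt_norm_sq (hX n) (hsub n hs)).mono (hsub n))
      (fun n => hK₁ _ (Z n) (hZR n) (hZK n)) hosc
    intro ε hε
    -- Coercivity gives 2α|x|² ≤ 2⟨x, Ax⟩, so this threshold yields |x| ≤ ε.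
    filter_upwards [hsm (2 * α * ε ^ 2) (by have := h.pos; positivity)] with n hn s hs
    have h1 := hn s hs
    have h2 := h.coercive (X n s).fst.fst
    rw [Real.norm_eq_abs, abs_le] at h1
    refine le_of_sq_le_sq ?_ hε.le
    refine le_of_mul_le_mul_left ?_ h.pos
    linarith [h1.1]
  have small_Ax : UnifSmall a T fun n s => A (X n s).fst.fst :=
    small_x.of_le ‖A‖ fun n s _ => A.le_opNorm _
  have small_w' : UnifSmall a T fun n s => C (X n s).snd (X n s).fst.fst := by
    refine small_x.of_le (‖C‖ * R) fun n s hs => (C.le_opNorm₂ _ _).trans ?_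
    gcongr
    exact hzR n s hs
  -- `B w z` is small, from the first equation
  have small_p : UnifSmall a T fun n s => B (X n s).fst.snd (X n s).snd := by
    obtain ⟨K₂, hK₂⟩ := exists_lipschitz_comp ((A.contDiff.comp cx).neg.sub (cB cw cz)) R K
    have hsm := UnifSmall.deriv hT hdx (fun n => hK₂ _ (Z n) (hZR n) (hZK n))
      (UnifSmall.oscillation_of_small hT.le small_x)
    refine (small_Ax.add hsm).of_le 1 fun n s _ => ?_
    rw [one_mul, ← norm_neg]
    apply le_of_eq
    congr 1
    abel
  -- `B w φ` is small, from the derivative of `B w z`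
  have small_q : UnifSmall a T fun n s => B (X n s).fst.snd (φ s (X n s).fst) := by
    obtain ⟨K₃, hK₃⟩ := exists_lipschitz_comp ((cB cC cz).add (cB cw (cz.neg.add cu))) R K
    have hdp : ∀ n, ∀ s ∈ Icc (a n) (a n + T),
        HasDerivWithinAt (fun s => B (X n s).fst.snd (X n s).snd)
          (B (C (X n s).snd (X n s).fst.fst) (X n s).snd
            + B (X n s).fst.snd (-(X n s).snd + φ s (X n s).fst)) (Icc (a n) (a n + T)) s :=
      fun n s hs =>
        (B.hasFDerivAt.comp_hasDerivWithinAt s (hdw n s hs)).clm_apply (hdz n s hs)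
    have hsm := UnifSmall.deriv hT hdp (fun n => hK₃ _ (Z n) (hZR n) (hZK n))
      (UnifSmall.oscillation_of_small hT.le small_p)
    have hBC : UnifSmall a T fun n s => B (C (X n s).snd (X n s).fst.fst) (X n s).snd := by
      refine small_w'.of_le (‖B‖ * R) fun n s hs => (B.le_opNorm₂ _ _).trans ?_
      rw [mul_right_comm]
      gcongr
      exact hzR n s hs
    refine ((hsm.sub hBC).add small_p).of_le 1 fun n s _ => ?_
    rw [one_mul, map_add, map_neg]
    apply le_of_eq
    congr 1
    abel
  -- `w` is nearly constant on the windows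
  have small_Δ := UnifSmall.oscillation hT hdw small_w'
  refine ⟨small_x, ?_⟩
  have hΔ : UnifSmall a T fun n s =>
      B ((X n s).fst.snd - (X n (a n)).fst.snd) (φ s (X n s).fst) := by
    refine small_Δ.of_le (‖B‖ * R) fun n s hs => (B.le_opNorm₂ _ _).trans ?_
    rw [mul_right_comm]
    gcongr
    exact hφR n s hs
  refine (small_q.sub hΔ).of_le 1 fun n s _ => ?_
  rw [one_mul, map_sub, _root_.sub_apply, sub_sub_cancel]

theorem attractive (h : IsAdaptiveLoop A B C φ ρ α)
    (hPE : IsExcitedAlong B φ (loopField A B C φ)) {r σ : ℝ} (hr : 0 < r) (hσ : 0 < σ) :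
    ∃ T : ℝ, 0 < T ∧ ∀ t₀ : ℝ, 0 ≤ t₀ → ∀ X : ℝ → WithLp 2 (WithLp 2 (E₁ × E₂) × E₁),
      IsSolutionOn (loopField A B C φ) (Ici t₀) X → ‖X t₀‖ < r →
      ∀ t : ℝ, t₀ + T ≤ t → ‖(X t).fst‖ ≤ σ := by
  obtain ⟨T, μ, hT, hμ, hexc⟩ := hPE r σ hr hσ
  by_contra! hcon
  -- A failure time beyond (n + 1)T leaves room for n + 1 windows of length T.
  choose t₀ ht₀ X hX hXr t ht hσt using fun n : ℕ => hcon ((n + 1) * T) (by positivity)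
  have hanti := fun n => h.antitoneOn_norm (convex_Ici _) (hX n)
  have hk : ∀ n : ℕ, ∃ k ≤ n, ‖(X n (t₀ n + k * T)).fst‖ ^ 2
      - ‖(X n (t₀ n + (k + 1 : ℕ) * T)).fst‖ ^ 2 ≤ r ^ 2 / (n + 1) := by
    intro n
    refine exists_small_decrement (V := fun k : ℕ => ‖(X n (t₀ n + k * T)).fst‖ ^ 2) ?_
      (fun k => by positivity) n
    have := (norm_fst_le (X n (t₀ n))).trans (hXr n).le
    simpa using pow_le_pow_left₀ (norm_nonneg _) this 2
  choose k hkn hk using hk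
  set a : ℕ → ℝ := fun n => t₀ n + k n * T with ha
  have hta : ∀ n, t₀ n ≤ a n := fun n => le_add_of_nonneg_right (by positivity)
  have haT : ∀ n, a n + T ≤ t n := by
    intro n
    have : (k n : ℝ) ≤ n := by exact_mod_cast hkn n
    have := mul_le_mul_of_nonneg_right this hT.le
    simp only [ha]
    linarith [ht n]
  have hlow : ∀ n, ∀ s ∈ Icc (a n) (a n + T), σ ≤ ‖(X n s).fst‖ := fun n s hs =>
    (hσt n).le.trans (hanti n ((hta n).trans hs.1)
      ((hta n).trans (hs.1.trans (hs.2.trans (haT n)))) (hs.2.trans (haT n)))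
  obtain ⟨hx, hq⟩ := h.unifSmall_windows hT ht₀ hX hXr hta (fun ε hε => by
    have hlim : Tendsto (fun n : ℕ => r ^ 2 / ((n : ℝ) + 1)) atTop (𝓝 0) :=
      tendsto_const_div_atTop_nhds_zero_nat (r ^ 2) |>.comp (tendsto_add_atTop_nat 1) |>.congr
        fun n => by simp
    filter_upwards [hlim.eventually_le_const hε] with n hn
    refine le_trans ?_ hn
    have h1 := hk n
    have h2 : t₀ n + (k n + 1 : ℕ) * T = a n + T := by simp only [ha]; push_cast; ring
    rwa [h2] at h1)
  -- With both components of ξ at most σ/4, the norm is at most σ/2, against the lower bound σ.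
  obtain ⟨n, hn1, hn2⟩ := ((hx (σ / 4) (by positivity)).and
    (hq (μ * (σ / 4)) (by positivity))).exists
  have hmem : a n ∈ Icc (a n) (a n + T) := ⟨le_rfl, by linarith⟩
  have hw : ‖(X n (a n)).fst.snd‖ ≤ σ / 4 := by
    refine le_of_mul_le_mul_left ?_ hμ
    exact hexc (t₀ n) (ht₀ n) (X n) (hXr n) (hX n) (a n) (hta n) (hlow n) _ _ hn2
  linarith [hn1 _ hmem, hlow n _ hmem, norm_le_fst_add_snd (X n (a n)).fst]

theorem isUGASWith_fst (h : IsAdaptiveLoop A B C φ ρ α)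
    (hPE : IsExcitedAlong B φ (loopField A B C φ)) :
    IsUGASWith (fun X : WithLp 2 (WithLp 2 (E₁ × E₂) × E₁) => X.fst) (loopField A B C φ) where
  complete _ ht₀ x₀ := h.complete ht₀ x₀
  stable := ⟨id, ⟨continuousOn_id, strictMono_id.strictMonoOn _, rfl, tendsto_id⟩,
    fun _ _ _ _ hX _ ht =>
      h.antitoneOn_norm (convex_Ico _ _) hX ⟨le_rfl, ht.1.trans_lt ht.2⟩ ht ht.1⟩
  attractive _ _ hr hσ := h.attractive hPE hr hσ

/-- Compare with φ(t, 0) = 0. The Lipschitz bound is on an open ball, hence the radius s + 1. -/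
theorem norm_input_le_mul (h : IsAdaptiveLoop A B C φ ρ α) (hφ0 : ∀ t : ℝ, 0 ≤ t → φ t 0 = 0)
    {t : ℝ} (ht : 0 ≤ t) {s : ℝ} {ξ : WithLp 2 (E₁ × E₂)} (hξ : ‖ξ‖ ≤ s) :
    ‖φ t ξ‖ ≤ ρ (s + 1) * s := by
  have hs : 0 ≤ s := (norm_nonneg _).trans hξ
  have h1 := h.growth.norm_sub_le h.lip ht (R := s + 1) (x := 0) (y := ξ)
    (by rw [norm_zero]; linarith) (by linarith)
  rw [hφ0 t ht, sub_zero, sub_zero] at h1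
  refine h1.trans ?_
  have := h.growth.nonneg (s + 1) (by linarith)
  gcongr

theorem isUGAS (h : IsAdaptiveLoop A B C φ ρ α)
    (hPE : IsExcitedAlong B φ (loopField A B C φ)) (hφ0 : ∀ t : ℝ, 0 ≤ t → φ t 0 = 0) :
    IsUGAS (loopField A B C φ) where
  complete _ ht₀ x₀ := h.complete ht₀ x₀
  stable := by
    -- One s bounds ξ, the other the initial value of the filter, and the last term its input.
    refine ⟨fun s => 2 * s + ρ (s + 1) * s, ⟨?_, ?_, by simp, ?_⟩, ?_⟩
    · refine (continuousOn_const.mul continuousOn_id).add (ContinuousOn.mul ?_ continuousOn_id)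
      exact h.growth.continuousOn.comp (f := fun s : ℝ => s + 1) (by fun_prop)
        fun s hs => mem_Ici.2 (by linarith [mem_Ici.1 hs])
    · intro s hs t ht hst
      have hs0 : (0 : ℝ) ≤ s := hs
      have h1 : ρ (s + 1) ≤ ρ (t + 1) := h.rho_mono (by linarith) (by linarith)
      have h2 : 0 ≤ ρ (s + 1) := h.growth.nonneg _ (by linarith)
      have h3 : ρ (s + 1) * s ≤ ρ (t + 1) * t := mul_le_mul h1 hst.le hs0 (h2.trans h1)
      simp only
      linarith
    · refine tendsto_atTop_mono' atTop ?_ tendsto_id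
      filter_upwards [eventually_ge_atTop (0 : ℝ)] with s hs
      have h2 : 0 ≤ ρ (s + 1) * s := mul_nonneg (h.growth.nonneg _ (by linarith)) hs
      simp only [id]
      linarith
    · intro t₀ t₁ ht₀ X hX t ht
      have hmem : t₀ ∈ Ico t₀ t₁ := ⟨le_rfl, ht.1.trans_lt ht.2⟩
      have hsub : Icc t₀ t ⊆ Ico t₀ t₁ := fun s hs => ⟨hs.1, hs.2.trans_lt ht.2⟩
      have hanti := h.antitoneOn_norm (convex_Ico _ _) hX
      have hfst : ∀ s ∈ Ico t₀ t₁, ‖(X s).fst‖ ≤ ‖X t₀‖ := fun s hs =>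
        (hanti hmem hs hs.1).trans (norm_fst_le _)
      have h1 := h.norm_snd_le_of_bound ht.1 hsub hX (c := ρ (‖X t₀‖ + 1) * ‖X t₀‖)
        fun s hs => h.norm_input_le_mul hφ0 (ht₀.trans hs.1) (hfst s (hsub hs))
      have h2 : Real.exp (-(t - t₀)) * ‖(X t₀).snd‖ ≤ ‖X t₀‖ :=
        (mul_le_of_le_one_left (norm_nonneg _)
          (Real.exp_le_one_iff.2 (by linarith [ht.1]))).trans (SignedNetwork.norm_snd_le _)
      have h3 := norm_le_fst_add_snd (X t)
      have h4 := hfst t ht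
      simp only [id]
      linarith
  attractive := by
    intro r σ hr hσ
    have hρ : 0 ≤ ρ (r + 1) := h.growth.nonneg _ (by linarith)
    have hρ' : 0 ≤ ρ r := h.growth.nonneg _ hr.le
    set c := ρ (r + 1) + 1 with hc
    have hc1 : 1 ≤ c := by linarith
    -- Once |ξ| ≤ σ', ξ and the forced part of z together contribute at most cσ' ≤ σ/3, and the
    -- transient of z another σ/3. The minimum with r allows ρ(σ' + 1) ≤ ρ(r + 1).
    set σ' := min (σ / (3 * c)) r with hσ'
    have hσ'0 : 0 < σ' := by positivity
    have hσ'c : c * σ' ≤ σ / 3 := by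
      calc c * σ' ≤ c * (σ / (3 * c)) := by gcongr; exact min_le_left _ _
        _ = σ / 3 := by field_simp
    obtain ⟨T₁, hT₁, hatt⟩ := h.attractive hPE hr hσ'0
    have hlim : Tendsto (fun s : ℝ => Real.exp (-s) * (r + ρ r)) atTop (𝓝 0) := by
      simpa using (Real.tendsto_exp_neg_atTop_nhds_zero).mul_const (r + ρ r)
    obtain ⟨T₂, hT₂0, hT₂⟩ := ((eventually_gt_atTop (0 : ℝ)).and
      (hlim.eventually_le_const (show 0 < σ / 3 by positivity))).exists
    refine ⟨T₁ + T₂, by positivity, fun t₀ ht₀ X hX hXr t ht => ?_⟩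
    have hξ : ∀ s, t₀ + T₁ ≤ s → ‖(X s).fst‖ ≤ σ' := hatt t₀ ht₀ X hX hXr
    have hsub : Icc (t₀ + T₁) t ⊆ Ici t₀ := fun s hs => by
      have := hs.1
      exact mem_Ici.2 (by linarith)
    have hle : t₀ + T₁ ≤ t := by linarith
    have h1 := h.norm_snd_le_of_bound hle hsub hX (c := ρ (r + 1) * σ') fun s hs => by
      have h2 := h.norm_input_le_mul hφ0 (ht₀.trans (hsub hs)) (hξ s hs.1)
      refine h2.trans ?_
      have := h.rho_mono (s := σ' + 1) (t := r + 1) (by linarith)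
        (by linarith [min_le_right (σ / (3 * c)) r])
      gcongr
    have h2 := h.norm_snd_le (convex_Ici _) ht₀ self_mem_Ici (hsub ⟨le_rfl, hle⟩)
      (by linarith) hX
    have h3 : ‖(X t₀).snd‖ ≤ r := (SignedNetwork.norm_snd_le _).trans hXr.le
    have h4 : ρ ‖(X t₀).fst‖ ≤ ρ r :=
      h.rho_mono (norm_nonneg _) ((norm_fst_le _).trans hXr.le)
    have h5 : Real.exp (-(t - (t₀ + T₁))) * ‖(X (t₀ + T₁)).snd‖ ≤ Real.exp (-T₂) * (r + ρ r) := by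
      gcongr
      · linarith
      · linarith
    have h6 := norm_le_fst_add_snd (X t)
    have h7 := hξ t hle
    have h8 : c * σ' = ρ (r + 1) * σ' + σ' := by rw [hc]; ring
    simp only [id]
    linarith

end IsAdaptiveLoop

end Attractivity

/-! ## The signed network as an adaptive loop -/

section Matrices

theorem inner_act {m n : Type*} [Fintype m] [Fintype n] (M : Matrix m n ℝ)
    (x : EuclideanSpace ℝ m) (y : EuclideanSpace ℝ n) :
    inner ℝ x (act M y) = inner ℝ (act Mᵀ x) y := by
  simp only [act, EuclideanSpace.inner_eq_star_dotProduct, star_trivial]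
  rw [dotProduct_comm, Matrix.dotProduct_mulVec, dotProduct_comm, Matrix.mulVec_transpose]

theorem act_mul {l m n : Type*} [Fintype m] [Fintype n] (M : Matrix l m ℝ) (M' : Matrix m n ℝ)
    (x : EuclideanSpace ℝ n) : act (M * M') x = act M (act M' x) := by
  simp [act, Matrix.mulVec_mulVec]

theorem act_add {m n : Type*} [Fintype n] (M : Matrix m n ℝ) (x y : EuclideanSpace ℝ n) :
    act M (x + y) = act M x + act M y := by
  simp [act, Matrix.mulVec_add]

theorem act_sub {m n : Type*} [Fintype n] (M : Matrix m n ℝ) (x y : EuclideanSpace ℝ n) :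
    act M (x - y) = act M x - act M y := by
  simp [act, Matrix.mulVec_sub]

theorem act_smul {m n : Type*} [Fintype n] (M : Matrix m n ℝ) (c : ℝ) (x : EuclideanSpace ℝ n) :
    act M (c • x) = c • act M x := by
  simp [act, Matrix.mulVec_smul]

theorem add_act {m n : Type*} [Fintype n] (M M' : Matrix m n ℝ) (x : EuclideanSpace ℝ n) :
    act (M + M') x = act M x + act M' x := by
  simp [act, Matrix.add_mulVec]

theorem sub_act {m n : Type*} [Fintype n] (M M' : Matrix m n ℝ) (x : EuclideanSpace ℝ n) :
    act (M - M') x = act M x - act M' x := by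
  simp [act, Matrix.sub_mulVec]

theorem smul_act {m n : Type*} [Fintype n] (c : ℝ) (M : Matrix m n ℝ) (x : EuclideanSpace ℝ n) :
    act (c • M) x = c • act M x := by
  simp [act, Matrix.smul_mulVec]

theorem one_act {n : Type*} [Fintype n] [DecidableEq n] (x : EuclideanSpace ℝ n) :
    act (1 : Matrix n n ℝ) x = x := by
  simp [act]

theorem act_diagonal {n : Type*} [Fintype n] [DecidableEq n] (d : n → ℝ)
    (x : EuclideanSpace ℝ n) : act (Matrix.diagonal d) x = WithLp.toLp 2 fun e => d e * x e := by
  ext e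
  simp [act, Matrix.mulVec_diagonal]

theorem act_apply {m n : Type*} [Fintype n] (M : Matrix m n ℝ) (x : EuclideanSpace ℝ n) (i : m) :
    act M x i = ∑ j, M i j * x j := rfl

/-- Each eigenvalue of L - lI becomes one of L after adding l, so L - lI is positive semidefinite.
-/
theorem mul_norm_sq_le_inner_act {n : Type*} [Fintype n] [DecidableEq n] {L : Matrix n n ℝ}
    (hL : L.IsHermitian) {l : ℝ} (hl : ∀ μ, Module.End.HasEigenvalue (Matrix.toLin' L) μ → l ≤ μ)
    (x : EuclideanSpace ℝ n) : l * ‖x‖ ^ 2 ≤ inner ℝ x (act L x) := by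
  have hM : (L - l • (1 : Matrix n n ℝ)).IsHermitian := by
    refine hL.sub ?_
    rw [Matrix.IsHermitian, Matrix.conjTranspose_smul, Matrix.conjTranspose_one, star_trivial]
  have hpsd : (L - l • (1 : Matrix n n ℝ)).PosSemidef := by
    refine hM.posSemidef_iff_eigenvalues_nonneg.2 fun i => ?_
    have h1 := hM.mulVec_eigenvectorBasis i
    have h2 : Module.End.HasEigenvector (Matrix.toLin' L) (l + hM.eigenvalues i)
        (hM.eigenvectorBasis i).ofLp := by
      rw [Module.End.hasEigenvector_iff, Module.End.mem_eigenspace_iff]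
      refine ⟨?_, ?_⟩
      · rw [Matrix.sub_mulVec, Matrix.smul_mulVec, Matrix.one_mulVec, sub_eq_iff_eq_add] at h1
        rw [Matrix.toLin'_apply, h1, add_smul, add_comm]
      · intro h0
        exact hM.eigenvectorBasis.orthonormal.ne_zero i (by ext j; exact congrFun h0 j)
    have h3 := hl _ (Module.End.hasEigenvalue_of_hasEigenvector h2)
    simpa using h3
  have h1 := hpsd.dotProduct_mulVec_nonneg x.ofLp
  have h2 : inner ℝ x (act (L - l • (1 : Matrix n n ℝ)) x)
      = star x.ofLp ⬝ᵥ ((L - l • (1 : Matrix n n ℝ)) *ᵥ x.ofLp) := by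
    rw [EuclideanSpace.inner_eq_star_dotProduct, dotProduct_comm]
    rfl
  rw [← h2, sub_act, smul_act, one_act, inner_sub_right, real_inner_smul_right,
    real_inner_self_eq_norm_sq] at h1
  linarith

theorem dotProduct_excitationGram_mulVec {ι : Type*} [Fintype ι] {v : ℝ → EuclideanSpace ℝ ι}
    {t T : ℝ} (hv : ContinuousOn v (uIcc t (t + T))) (m : ι → ℝ) :
    m ⬝ᵥ (excitationGram v t T *ᵥ m) = ∫ τ in t..(t + T), (∑ i, m i * v τ i) ^ 2 := by
  have hc : ∀ i, ContinuousOn (fun τ => v τ i) (uIcc t (t + T)) := fun i =>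
    (EuclideanSpace.proj (𝕜 := ℝ) i).continuous.comp_continuousOn hv
  have hint : ∀ i j, IntervalIntegrable (fun τ => m i * v τ i * (m j * v τ j)) volume t (t + T) :=
    fun i j => ((continuousOn_const.mul (hc i)).mul
      (continuousOn_const.mul (hc j))).intervalIntegrable
  have h1 : ∀ τ, (∑ i, m i * v τ i) ^ 2 = ∑ i, ∑ j, m i * v τ i * (m j * v τ j) := fun τ => by
    rw [sq, Finset.sum_mul_sum]
  simp only [h1]
  have hint' : ∀ i, IntervalIntegrable (fun τ => ∑ j, m i * v τ i * (m j * v τ j)) volume t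
      (t + T) := fun i => by
    simpa only [Finset.sum_fn] using IntervalIntegrable.sum Finset.univ fun j _ => hint i j
  rw [intervalIntegral.integral_finsetSum fun i _ => hint' i]
  simp only [dotProduct, Matrix.mulVec, Finset.mul_sum]
  refine Finset.sum_congr rfl fun i _ => ?_
  rw [intervalIntegral.integral_finsetSum fun j _ => hint i j]
  refine Finset.sum_congr rfl fun j _ => ?_
  rw [excitationGram, Matrix.of_apply, ← mul_assoc, mul_right_comm,
    ← intervalIntegral.integral_const_mul]
  congr 1
  ext τ
  ring

end Matrices

section Convergence

theorem IsUGASWith.tendsto_zero {E F : Type*} [NormedAddCommGroup E] [NormedSpace ℝ E]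
    [NormedAddCommGroup F] {h : E → F} {f : ℝ → E → E} (hf : IsUGASWith h f) {t₀ : ℝ}
    (ht₀ : 0 ≤ t₀) {X : ℝ → E} (hX : IsSolutionOn f (Ici t₀) X) :
    Tendsto (fun t => h (X t)) atTop (𝓝 0) := by
  refine Metric.tendsto_atTop.2 fun ε hε => ?_
  obtain ⟨T, _, hT⟩ := hf.attractive (‖X t₀‖ + 1) (ε / 2) (by positivity) (by positivity)
  refine ⟨t₀ + T, fun t ht => ?_⟩
  rw [dist_zero_right]
  linarith [hT t₀ ht₀ X hX (by linarith) t ht]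

end Convergence

/-! ### Incidence algebra, transfer of excitation, and the change of coordinates -/

section Network

variable {N : ℕ} (G : SignedGraph N) (o : EdgeOrientation N)

theorem EdgeOrientation.src_ne_tgt (e : Edge N) : o.src e ≠ o.tgt e := by
  intro h
  apply e.2
  rw [← o.spec e, h]
  exact Sym2.mk_isDiag_iff.2 rfl

theorem EdgeOrientation.act_incidence_transpose (x : NodeVec N) (e : Edge N) :
    act o.incidenceᵀ x e = x (o.src e) - x (o.tgt e) := by
  have h : ∀ i, o.incidenceᵀ e i * x i
      = (if i = o.src e then x i else 0) - (if i = o.tgt e then x i else 0) := by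
    intro i
    have := o.src_ne_tgt e
    simp only [EdgeOrientation.incidence, Matrix.transpose_apply, Matrix.of_apply]
    by_cases h1 : i = o.src e
    · simp [h1, this]
    · by_cases h2 : i = o.tgt e
      · subst h2
        simp [this.symm]
      · simp [h1, h2]
  rw [act_apply]
  simp only [h, Finset.sum_sub_distrib, Finset.sum_ite_eq', Finset.mem_univ, if_true]

/-- Only the edge {i, j} is incident to both nodes, and its two incidence entries have opposite
signs in either orientation. -/
theorem EdgeOrientation.estLaplacian_apply_of_ne (w : EdgeVec N) {i j : Fin N} (hij : i ≠ j) :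
    o.estLaplacian w i j = -w ⟨s(i, j), by simpa using hij⟩ := by
  set e₀ : Edge N := ⟨s(i, j), by simpa using hij⟩ with he₀
  have hsum : o.estLaplacian w i j = ∑ e, o.incidence i e * w e * o.incidence j e := by
    rw [EdgeOrientation.estLaplacian, Matrix.mul_apply]
    simp only [Matrix.mul_diagonal, Matrix.transpose_apply]
  rw [hsum, Finset.sum_eq_single e₀]
  · have h := o.spec e₀
    have hne := o.src_ne_tgt e₀
    simp only [he₀, Sym2.eq_iff] at h
    simp only [EdgeOrientation.incidence, Matrix.of_apply, ← he₀] at h ⊢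
    rcases h with ⟨h1, h2⟩ | ⟨h1, h2⟩ <;> simp [h1, h2, hij, hij.symm]
  · intro e _ hne
    have hspec := o.spec e
    simp only [EdgeOrientation.incidence, Matrix.of_apply]
    have hmem : ¬((i = o.src e ∨ i = o.tgt e) ∧ (j = o.src e ∨ j = o.tgt e)) := by
      rintro ⟨h1, h2⟩
      apply hne
      apply Subtype.ext
      rw [← hspec, he₀, Sym2.eq_iff]
      rcases h1 with h1 | h1 <;> rcases h2 with h2 | h2
      · exact absurd (h1.trans h2.symm) hij
      · exact Or.inl ⟨h1.symm, h2.symm⟩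
      · exact Or.inr ⟨h2.symm, h1.symm⟩
      · exact absurd (h1.trans h2.symm) hij
    by_cases hi : i = o.src e ∨ i = o.tgt e
    · have hj : ¬(j = o.src e ∨ j = o.tgt e) := fun hj => hmem ⟨hi, hj⟩
      push Not at hj
      simp [hj.1, hj.2]
    · push Not at hi
      simp [hi.1, hi.2]
  · simp

theorem EdgeOrientation.act_estLaplacian (w : EdgeVec N) (z : NodeVec N) :
    act (o.estLaplacian w) z
      = act o.incidence (WithLp.toLp 2 fun e => w e * act o.incidenceᵀ z e) := by
  rw [EdgeOrientation.estLaplacian, Matrix.mul_assoc, act_mul, act_mul, act_diagonal]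

/-- The entrywise product of w and Ēᵀz is symmetric in its factors; this exhibits the coupling as
bilinear in (w, z). -/
theorem EdgeOrientation.act_incidence_mul_zDiag (w : EdgeVec N) (z : NodeVec N) :
    act (o.incidence * o.zDiag z) w = act (o.estLaplacian w) z := by
  rw [o.act_estLaplacian, act_mul, EdgeOrientation.zDiag, act_diagonal]
  simp only [mul_comm]

theorem EdgeOrientation.act_zDiag_mul_apply (z x : NodeVec N) (e : Edge N) :
    act (o.zDiag z * o.incidenceᵀ) x e = act o.incidenceᵀ z e * act o.incidenceᵀ x e := by
  rw [act_mul, EdgeOrientation.zDiag, act_diagonal]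

theorem EdgeOrientation.estLaplacian_row_sum (w : EdgeVec N) (i : Fin N) :
    ∑ j, o.estLaplacian w i j = 0 := by
  have h1 : act (o.estLaplacian w) (WithLp.toLp 2 fun _ => 1) i = ∑ j, o.estLaplacian w i j := by
    simp [act_apply]
  rw [← h1, o.act_estLaplacian, act_apply]
  simp [o.act_incidence_transpose]

/-- The off-diagonal entries agree and both matrices have zero row sums, which forces the diagonals
to agree. -/
theorem SignedGraph.laplacian_eq_estLaplacian : G.laplacian = o.estLaplacian (G.weights o) := by
  have hoff : ∀ i j, i ≠ j → G.laplacian i j = o.estLaplacian (G.weights o) i j := by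
    intro i j hij
    rw [o.estLaplacian_apply_of_ne _ hij]
    have h := o.spec ⟨s(i, j), by simpa using hij⟩
    simp only [Sym2.eq_iff] at h
    simp only [SignedGraph.laplacian, Matrix.of_apply, if_neg hij, SignedGraph.weights]
    rcases h with ⟨h1, h2⟩ | ⟨h1, h2⟩
    · rw [h1, h2]
    · rw [h1, h2, G.symm]
  have hrow : ∀ i, ∑ j, G.laplacian i j = 0 := by
    intro i
    have : ∀ j, G.laplacian i j = (if i = j then ∑ k, G.a i k else 0) - G.a i j := by
      intro j
      by_cases hij : i = j
      · subst hij
        simp [SignedGraph.laplacian, G.loopless]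
      · simp [SignedGraph.laplacian, hij]
    simp [this]
  ext i j
  by_cases hij : i = j
  · subst hij
    have h1 := hrow i
    have h2 := o.estLaplacian_row_sum (G.weights o) i
    rw [← Finset.add_sum_erase _ _ (Finset.mem_univ i)] at h1 h2
    have h3 : ∑ j ∈ Finset.univ.erase i, G.laplacian i j
        = ∑ j ∈ Finset.univ.erase i, o.estLaplacian (G.weights o) i j :=
      Finset.sum_congr rfl fun j hj => hoff i j (Finset.ne_of_mem_erase hj).symm
    linarith
  · exact hoff i j hij

theorem SignedGraph.laplacian_isHermitian : G.laplacian.IsHermitian := by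
  ext i j
  simp only [Matrix.conjTranspose_apply, star_trivial, SignedGraph.laplacian, Matrix.of_apply]
  by_cases hij : i = j
  · subst hij; rfl
  · rw [if_neg hij, if_neg (Ne.symm hij), G.symm]

theorem SignedGraph.act_laplacian_apply (x : NodeVec N) (i : Fin N) :
    act G.laplacian x i = ∑ j, G.a i j * (x i - x j) := by
  have : ∀ j, G.laplacian i j * x j
      = (if i = j then (∑ k, G.a i k) * x j else 0) - G.a i j * x j := by
    intro j
    by_cases hij : i = j
    · subst hij
      simp [SignedGraph.laplacian, G.loopless]
    · simp [SignedGraph.laplacian, hij]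
  rw [act_apply]
  simp only [this, Finset.sum_sub_distrib, Finset.sum_ite_eq, Finset.mem_univ, if_true, mul_sub,
    Finset.sum_mul]

/-- `M` as a continuous linear map. -/
def actCLM (M : Matrix (Fin N) (Fin N) ℝ) : NodeVec N →L[ℝ] NodeVec N :=
  LinearMap.toContinuousLinearMap
    { toFun := act M
      map_add' := act_add M
      map_smul' := act_smul M }

/-- `(w, z) ↦ Ē diag(w) Ēᵀ z` as a continuous bilinear map. -/
def EdgeOrientation.estCLM : EdgeVec N →L[ℝ] NodeVec N →L[ℝ] NodeVec N :=
  (LinearMap.mk₂ ℝ (fun w z => act (o.estLaplacian w) z)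
    (fun w w' z => by simp only [← o.act_incidence_mul_zDiag, act_add])
    (fun c w z => by simp only [← o.act_incidence_mul_zDiag, act_smul])
    (fun w z z' => act_add _ _ _) (fun c w z => act_smul _ _ _)).toContinuousBilinearMap

/-- `(z, x) ↦ diag(Ēᵀ z) Ēᵀ x` as a continuous bilinear map. -/
def EdgeOrientation.updateCLM : NodeVec N →L[ℝ] NodeVec N →L[ℝ] EdgeVec N :=
  (LinearMap.mk₂ ℝ (fun z x => act (o.zDiag z * o.incidenceᵀ) x)
    (fun z z' x => by
      ext e
      simp only [o.act_zDiag_mul_apply, act_add, PiLp.add_apply, add_mul])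
    (fun c z x => by
      ext e
      simp only [o.act_zDiag_mul_apply, act_smul, PiLp.smul_apply, smul_eq_mul, mul_assoc])
    (fun z x x' => act_add _ _ _) (fun c z x => act_smul _ _ _)).toContinuousBilinearMap

theorem EdgeOrientation.estCLM_apply (w : EdgeVec N) (z : NodeVec N) :
    o.estCLM w z = act (o.estLaplacian w) z := rfl

theorem EdgeOrientation.updateCLM_apply (z x : NodeVec N) :
    o.updateCLM z x = act (o.zDiag z * o.incidenceᵀ) x := rfl

/-- Both sides equal the sum over edges of w(e) (Ēᵀz)(e) (Ēᵀx)(e). -/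
theorem EdgeOrientation.inner_estCLM (x : NodeVec N) (w : EdgeVec N) (z : NodeVec N) :
    inner ℝ x (o.estCLM w z) = inner ℝ w (o.updateCLM z x) := by
  rw [o.estCLM_apply, o.act_estLaplacian, inner_act, PiLp.inner_apply, PiLp.inner_apply]
  refine Finset.sum_congr rfl fun e _ => ?_
  simp only [o.updateCLM_apply, o.act_zDiag_mul_apply, RCLike.inner_apply, conj_trivial]
  ring

variable (c₁ : ℝ) (φ : ℝ → ErrVec N → NodeVec N)

theorem errorField_eq_loopField : errorField G o c₁ φ
    = loopField (actCLM (c₁ • (1 : Matrix (Fin N) (Fin N) ℝ) + G.laplacian)) o.estCLM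
      o.updateCLM φ := by
  ext1 t
  ext1 X
  rw [errorField, o.act_incidence_mul_zDiag]
  rfl

variable {G o c₁ φ}

theorem isAdaptiveLoop {ρ : ℝ → ℝ}
    (hφ : LocallyLipschitzOn (Ici (0 : ℝ) ×ˢ (univ : Set (ErrVec N)))
      (fun p : ℝ × ErrVec N => φ p.1 p.2)) (hρ : GrowthBound φ ρ) {l : ℝ}
    (hl : ∀ μ, Module.End.HasEigenvalue (Matrix.toLin' G.laplacian) μ → l ≤ μ) (hc : -l < c₁) :
    IsAdaptiveLoop (actCLM (c₁ • (1 : Matrix (Fin N) (Fin N) ℝ) + G.laplacian)) o.estCLM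
      o.updateCLM φ ρ (c₁ + l) where
  lip := hφ
  growth := hρ
  pos := by linarith
  coercive x := by
    have h1 := mul_norm_sq_le_inner_act G.laplacian_isHermitian hl x
    have h2 : actCLM (c₁ • (1 : Matrix (Fin N) (Fin N) ℝ) + G.laplacian) x
        = c₁ • x + act G.laplacian x := by
      change act _ x = _
      rw [add_act, smul_act, one_act]
    rw [h2, inner_add_right, real_inner_smul_right, real_inner_self_eq_norm_sq]
    linarith
  adjoint := o.inner_estCLM

theorem EdgeOrientation.sq_weight_le (w : EdgeVec N) (e : Edge N) :
    w e ^ 2 ≤ ∑ j, o.estLaplacian w (o.src e) j ^ 2 := by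
  have h1 : o.estLaplacian w (o.src e) (o.tgt e) = -w e := by
    have h2 : (⟨s(o.src e, o.tgt e), by simpa using o.src_ne_tgt e⟩ : Edge N) = e :=
      Subtype.ext (o.spec e)
    rw [o.estLaplacian_apply_of_ne w (o.src_ne_tgt e), h2]
  calc w e ^ 2 = o.estLaplacian w (o.src e) (o.tgt e) ^ 2 := by rw [h1, neg_sq]
    _ ≤ ∑ j, o.estLaplacian w (o.src e) j ^ 2 :=
      Finset.single_le_sum (f := fun j => o.estLaplacian w (o.src e) j ^ 2)
        (fun j _ => sq_nonneg _) (Finset.mem_univ _)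

/-- Test the Gram inequality on the row m of Ē diag(w) Ēᵀ at an end of e: m contains -w(e), and m ·
v is a component of the vector bounded by η. -/
theorem EdgeOrientation.mul_sq_weight_le {v : ℝ → NodeVec N} {t T μ η : ℝ} (hT : 0 ≤ T)
    (hμ : 0 ≤ μ) (hv : ContinuousOn v (Icc t (t + T)))
    (hpsd : (excitationGram v t T - μ • (1 : Matrix (Fin N) (Fin N) ℝ)).PosSemidef)
    (w : EdgeVec N) (hη : ∀ s ∈ Icc t (t + T), ‖o.estCLM w (v s)‖ ≤ η) (e : Edge N) :
    μ * w e ^ 2 ≤ T * η ^ 2 := by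
  set m : Fin N → ℝ := fun j => o.estLaplacian w (o.src e) j with hm
  have huI : uIcc t (t + T) = Icc t (t + T) := uIcc_of_le (by linarith)
  have h1 := hpsd.dotProduct_mulVec_nonneg m
  rw [star_trivial, Matrix.sub_mulVec, dotProduct_sub, Matrix.smul_mulVec, Matrix.one_mulVec,
    dotProduct_smul, smul_eq_mul, dotProduct_excitationGram_mulVec (by rwa [huI])] at h1
  have h2 : w e ^ 2 ≤ m ⬝ᵥ m := by
    refine (o.sq_weight_le w e).trans_eq ?_
    simp only [dotProduct, hm, sq]
  have h3 : ‖∫ τ in t..(t + T), (∑ i, m i * v τ i) ^ 2‖ ≤ η ^ 2 * |t + T - t| := by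
    refine intervalIntegral.norm_integral_le_of_norm_le_const fun s hs => ?_
    have hs' : s ∈ Icc t (t + T) := by
      rw [← huI]
      exact uIoc_subset_uIcc hs
    have h4 : ‖∑ i, m i * v s i‖ ≤ η := (PiLp.norm_apply_le (o.estCLM w (v s)) (o.src e)).trans (hη s hs')
    rw [norm_pow]
    exact pow_le_pow_left₀ (norm_nonneg _) h4 2
  rw [add_sub_cancel_left, abs_of_nonneg hT] at h3
  have h5 := (le_abs_self _).trans h3
  have h6 := mul_le_mul_of_nonneg_left h2 hμ
  linarith

theorem isExcitedAlong
    (hφ : LocallyLipschitzOn (Ici (0 : ℝ) ×ˢ (univ : Set (ErrVec N)))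
      (fun p : ℝ × ErrVec N => φ p.1 p.2))
    (hPE : IsUDeltaPE (fun t (X : LoopVec N) => φ t X.fst) (errorField G o c₁ φ)) :
    IsExcitedAlong o.estCLM φ (errorField G o c₁ φ) := by
  intro r δ hr hδ
  obtain ⟨T, μ, hT, hμ, hexc⟩ := hPE r δ hr hδ
  set c : ℝ := ((Fintype.card (Edge N) : ℕ) : ℝ)
  have hc0 : 0 ≤ c := by positivity
  -- Summing the bound over the c edges gives μ|w|² ≤ cTη²; c + 1 avoids division by zero when there
  -- are no edges.
  refine ⟨T, √(μ / ((c + 1) * T)), hT, by positivity, fun t₀ ht₀ X hXr hX t ht hξ w η hη => ?_⟩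
  have hpsd := hexc t₀ ht₀ X hXr hX t ht hξ
  have hη0 : 0 ≤ η := (norm_nonneg _).trans (hη t ⟨le_rfl, by linarith⟩)
  have hcont : ContinuousOn (fun τ => φ τ (X τ).fst) (Icc t (t + T)) := by
    have h1 : ContinuousOn (fun τ => (τ, (X τ).fst)) (Icc t (t + T)) :=
      continuousOn_id.prodMk ((WithLp.fstL 2 ℝ (ErrVec N) (NodeVec N)).continuous.comp_continuousOn
        (hX.continuousOn.mono fun s hs => ht.trans hs.1))
    exact hφ.continuousOn.comp h1 fun s hs => ⟨(ht₀.trans ht).trans hs.1, mem_univ _⟩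
  have he := o.mul_sq_weight_le hT.le hμ.le hcont hpsd w hη
  have hsum : μ * ‖w‖ ^ 2 ≤ c * (T * η ^ 2) := by
    rw [EuclideanSpace.norm_sq_eq, Finset.mul_sum]
    refine (Finset.sum_le_card_nsmul _ _ (T * η ^ 2) fun e _ => ?_).trans_eq ?_
    · simpa using he e
    · rw [Finset.card_univ, nsmul_eq_mul]
  refine le_of_sq_le_sq ?_ hη0
  rw [mul_pow, Real.sq_sqrt (by positivity), div_mul_eq_mul_div, div_le_iff₀ (by positivity)]
  have : 0 ≤ T * η ^ 2 := by positivity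
  linarith

variable {f : Fin N → ℝ → ℝ}

/-- The input cancels F, and the remaining Lx̂ - L̂x̂ is the Laplacian of the weight error applied
to x̂. -/
theorem agents_rhs_apply (t : ℝ) (x xh : NodeVec N) (wh : EdgeVec N) (i : Fin N) :
    f i (x i) - ∑ j, G.a i j * (x i - x j) + controlInput G o f c₁ φ t x xh wh i
      = ((-act (c₁ • (1 : Matrix (Fin N) (Fin N) ℝ) + G.laplacian) (x - xh)
          - act (o.incidence * o.zDiag xh) (G.weights o - wh))
          + (-xh + φ t (errorOf G o x xh wh))) i := by
  have h1 : act (o.estLaplacian (G.weights o - wh)) xh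
      = act G.laplacian xh - act (o.estLaplacian wh) xh := by
    rw [← o.act_incidence_mul_zDiag, act_sub, o.act_incidence_mul_zDiag,
      o.act_incidence_mul_zDiag, ← G.laplacian_eq_estLaplacian]
  rw [o.act_incidence_mul_zDiag, h1, add_act, smul_act, one_act, act_sub, ← G.act_laplacian_apply]
  simp only [controlInput, PiLp.add_apply, PiLp.sub_apply, PiLp.neg_apply, PiLp.smul_apply]
  ring

theorem hasDerivWithinAt_nodeVec {x : ℝ → NodeVec N} {x' : NodeVec N} {J : Set ℝ} {t : ℝ} :
    HasDerivWithinAt x x' J t ↔ ∀ i, HasDerivWithinAt (fun s => x s i) (x' i) J t :=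
  ⟨fun h i => (EuclideanSpace.proj (𝕜 := ℝ) i).hasFDerivAt.comp_hasDerivWithinAt t h,
    fun h => (PiLp.continuousLinearEquiv 2 ℝ fun _ : Fin N => ℝ).symm.hasFDerivAt
      |>.comp_hasDerivWithinAt t (hasDerivWithinAt_pi.2 h)⟩

theorem IsNetworkTrajectory.isSolutionOn {t₀ : ℝ} {x xh : ℝ → NodeVec N} {wh : ℝ → EdgeVec N}
    (h : IsNetworkTrajectory G o f c₁ φ t₀ x xh wh) :
    IsSolutionOn (errorField G o c₁ φ) (Ici t₀)
      fun s => WithLp.toLp 2 (errorOf G o (x s) (xh s) (wh s), xh s) := by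
  intro t ht
  have hxh := h.auxiliary t ht
  have hx : HasDerivWithinAt x ((-act (c₁ • (1 : Matrix (Fin N) (Fin N) ℝ) + G.laplacian)
      (x t - xh t) - act (o.incidence * o.zDiag (xh t)) (G.weights o - wh t))
      + (-xh t + φ t (errorOf G o (x t) (xh t) (wh t)))) (Ici t₀) t := by
    refine hasDerivWithinAt_nodeVec.2 fun i => ?_
    rw [← agents_rhs_apply (f := f)]
    exact h.agents t ht i
  have hd := hx.sub hxh
  rw [add_sub_cancel_right] at hd
  have hw := (h.update t ht).const_sub (G.weights o)
  rw [neg_neg] at hw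
  exact (hd.withLp_mk hw).withLp_mk hxh

/-- Undoing the change of coordinates gives global network trajectories with no growth condition on
f, since f has been cancelled. -/
theorem IsSolutionOn.isNetworkTrajectory {t₀ : ℝ} {X : ℝ → LoopVec N}
    (hX : IsSolutionOn (errorField G o c₁ φ) (Ici t₀) X) :
    IsNetworkTrajectory G o f c₁ φ t₀ (fun s => (X s).fst.fst + (X s).snd) (fun s => (X s).snd)
      fun s => G.weights o - (X s).fst.snd := by
  have herr : ∀ t, errorOf G o ((X t).fst.fst + (X t).snd) (X t).snd
      (G.weights o - (X t).fst.snd) = (X t).fst := by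
    intro t
    rw [errorOf, add_sub_cancel_right, sub_sub_cancel]
    rfl
  have hx := fun t ht => (hX t ht).withLp_fst.withLp_fst
  have hw := fun t ht => (hX t ht).withLp_fst.withLp_snd
  have hz := fun t ht => (hX t ht).withLp_snd
  refine ⟨fun t ht => ?_, fun t ht => ?_, fun t ht => ?_⟩
  · have := (hx t ht).add (hz t ht)
    intro i
    rw [agents_rhs_apply, herr, add_sub_cancel_right, sub_sub_cancel]
    exact hasDerivWithinAt_nodeVec.1 this i
  · rw [herr]
    exact hz t ht
  · rw [add_sub_cancel_right]
    exact (hw t ht).const_sub _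

end Network

end SignedNetwork

end

open SignedNetwork
theorem proposition1 (N : ℕ) (G : SignedGraph N) (o : EdgeOrientation N)
    (f : Fin N → ℝ → ℝ) (_hf : ∀ i, ContDiff ℝ ∞ (f i))
    (φ : ℝ → ErrVec N → NodeVec N) (ρ : ℝ → ℝ)
    (_hφ : LocallyLipschitzOn (Ici (0 : ℝ) ×ˢ (univ : Set (ErrVec N)))
      (fun p : ℝ × ErrVec N => φ p.1 p.2))
    (_hρ : GrowthBound φ ρ)
    (lamMin : ℝ)
    (_hlam : IsLeast {μ : ℝ | Module.End.HasEigenvalue (Matrix.toLin' G.laplacian) μ} lamMin)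
    (c₁ : ℝ) (_hc : -lamMin < c₁)
    (_hPE : IsUDeltaPE (fun t (X : LoopVec N) => φ t X.fst) (errorField G o c₁ φ)) :
    -- the origin of the error system is uniformly globally asymptotically stable
    IsUGASWith (fun X : LoopVec N => X.fst) (errorField G o c₁ φ) ∧
    -- the controlled network has a trajectory from every initial condition
    (∀ t₀ : ℝ, 0 ≤ t₀ → ∀ (x₀ xh₀ : NodeVec N) (wh₀ : EdgeVec N),
      ∃ (x xh : ℝ → NodeVec N) (wh : ℝ → EdgeVec N),
        x t₀ = x₀ ∧ xh t₀ = xh₀ ∧ wh t₀ = wh₀ ∧ IsNetworkTrajectory G o f c₁ φ t₀ x xh wh) ∧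
    -- the weights are identified, and the network state converges to the auxiliary state
    (∀ t₀ : ℝ, 0 ≤ t₀ → ∀ (x xh : ℝ → NodeVec N) (wh : ℝ → EdgeVec N),
      IsNetworkTrajectory G o f c₁ φ t₀ x xh wh →
        Tendsto wh atTop (𝓝 (G.weights o)) ∧ Tendsto (fun t => x t - xh t) atTop (𝓝 0)) ∧
    -- if the origin is an equilibrium of the whole closed loop, it is uniformly globally
    -- asymptotically stable for the whole closed loop, and the network synchronizes
    ((∀ t : ℝ, 0 ≤ t → φ t 0 = 0) →
      IsUGAS (errorField G o c₁ φ) ∧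
      ∀ t₀ : ℝ, 0 ≤ t₀ → ∀ (x xh : ℝ → NodeVec N) (wh : ℝ → EdgeVec N),
        IsNetworkTrajectory G o f c₁ φ t₀ x xh wh →
          Tendsto x atTop (𝓝 0) ∧ Tendsto xh atTop (𝓝 0)) := by
  have hloop := isAdaptiveLoop (o := o) _hφ _hρ (fun μ hμ => _hlam.2 hμ) _hc
  have hexc := isExcitedAlong _hφ _hPE
  have hfield := errorField_eq_loopField G o c₁ φ
  rw [hfield] at hexc
  have hugas : IsUGASWith (fun X : LoopVec N => X.fst) (errorField G o c₁ φ) := by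
    rw [hfield]
    exact hloop.isUGASWith_fst hexc
  refine ⟨hugas, fun t₀ ht₀ x₀ xh₀ wh₀ => ?_, fun t₀ ht₀ x xh wh htraj => ?_, fun hφ0 => ?_⟩
  · obtain ⟨X, hX0, hX⟩ := hugas.complete t₀ ht₀ (WithLp.toLp 2 (errorOf G o x₀ xh₀ wh₀, xh₀))
    refine ⟨_, _, _, ?_, ?_, ?_, hX.isNetworkTrajectory⟩ <;> simp [hX0, errorOf]
  · have hξ := hugas.tendsto_zero ht₀ htraj.isSolutionOn
    have hx := ((WithLp.fstL 2 ℝ (NodeVec N) (EdgeVec N)).continuous.tendsto 0).comp hξ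
    have hw := ((WithLp.sndL 2 ℝ (NodeVec N) (EdgeVec N)).continuous.tendsto 0).comp hξ
    rw [map_zero] at hx hw
    refine ⟨?_, hx⟩
    simpa [Function.comp_def, errorOf] using hw.const_sub (G.weights o)
  · have hall : IsUGAS (errorField G o c₁ φ) := by
      rw [hfield]
      exact hloop.isUGAS hexc hφ0
    refine ⟨hall, fun t₀ ht₀ x xh wh htraj => ?_⟩
    have hX := IsUGASWith.tendsto_zero hall ht₀ htraj.isSolutionOn
    have hz := ((WithLp.sndL 2 ℝ (ErrVec N) (NodeVec N)).continuous.tendsto 0).comp hX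
    have hξ := ((WithLp.fstL 2 ℝ (ErrVec N) (NodeVec N)).continuous.tendsto 0).comp hX
    rw [map_zero] at hz hξ
    have hx := ((WithLp.fstL 2 ℝ (NodeVec N) (EdgeVec N)).continuous.tendsto 0).comp hξ
    rw [map_zero] at hx
    refine ⟨?_, hz⟩
    simpa [Function.comp_def, errorOf] using hx.add hz
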